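/- Let $c>0$ and $2\le m\le\infty$. Consider wave equations $u_{tt}+g(t,x,u,u_t)=c^2u_{xx}$ for $u(t,x)$, $(t,x)\in\mathbb{R}^2$, with $g$ non-singular, that is, $g\in C^m(\mathbb{R}^4)$. A differential function is a $C^m$ function of $t,x$ and finitely many of $u$, $u_t$ and their $x$-derivatives. A pair $(T,\Psi)$ of differential functions is a conservation law with multiplier $Q$ if $$(u_{tt}-c^2u_{xx}+g(t,x,u,u_t))\,Q=D_tT+D_x\Psi$$ holds identically, i.e. for all smooth functions $u(t,x)$. Two pairs $(T,\Psi)$ and $(T',\Psi')$ are locally equivalent if $T-T'=D_x\Theta$ and $\Psi-\Psi'=-D_t\Theta$ for some differential function $\Theta$. A conservation law is of energy-momentum type if its multiplier is $$Q=e^{at+bx}(c_1u_t+c_2u_x+c_0u),\qquad a,b,c_0,c_1,c_2\in\mathbb{R},\quad (c_0,c_1,c_2)\neq(0,0,0).$$ Below, $f$ denotes a $C^m$ function on $\mathbb{R}^2$, and $F(y,\kappa u)=\int_0^u f(y,\kappa s)\,ds$ denotes the antiderivative of $f(y,\kappa u)$ with respect to $u$. **Theorem.** Up to local equivalence and multiplication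 of $(T,\Psi)$ and $Q$ by a common nonzero constant, the only energy-momentum type conservation laws are the following, where $a,b$ are the constants in the multiplier, and each of them occurs only for $g$ of the indicated form with some $f\in C^m$. Conversely, for all real $a,b,\tilde c$, both choices of sign and every $f\in C^m$, each of them is a conservation law with the indicated multiplier. (i) (generalized momentum) $g=a u_t+f(t,u)$, $Q=e^{at}u_x$, $$T=e^{at}u_tu_x,\qquad \Psi=-\tfrac12e^{at}(u_t^2+c^2u_x^2)+e^{at}F(t,u).$$ (ii) (generalized energy) $g=a u_t+f(x-\tilde ct,e^{\frac a2t}u)\,e^{-\frac a2t}$, $Q=e^{at}(u_t+\tilde cu_x+\tfrac a2u)$ with $\tilde c$ a real constant, $$T=e^{at}\big(\tfrac12(u_t^2+c^2u_x^2)+(\tilde cu_x+\tfrac12au)u_t\big)+e^{\frac a2t}F(x-\tilde ct,e^{\frac a2t}u),$$ $$\Psi=-e^{at}\big(\tfrac12\tilde c(u_t^2+c^2u_x^2)+c^2(u_t+\tfrac12au)u_x\big)+\tilde ce^{\frac a2t}F(x-\tilde ct,e^{\frac a2t}u).$$ (iii) (generalized null energies) $g=(a\pm cb)u_t+\tfrac14(a\pm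 cb)^2u+f(x\pm ct,e^{\frac{a\pm cb}2t}u)\,e^{-\frac{a\mp3cb}2t}$, $Q=e^{at+bx}(u_t\mp cu_x+\tfrac{a\pm cb}2u)$, $$T=e^{at+bx}\big(\tfrac12(u_t\mp cu_x)^2+\tfrac12(a\pm cb)(u_t+\tfrac14(a\pm3cb)u)u\big)+e^{\frac{a\pm3cb}2t+bx}F(x\pm ct,e^{\frac{a\pm cb}2t}u),$$ $$\Psi=\pm ce^{at+bx}\big(\tfrac12(u_t\mp cu_x)^2-\tfrac12(a\pm cb)(\pm cu_x+\tfrac14(a\mp cb)u)u\big)\mp ce^{\frac{a\pm3cb}2t+bx}F(x\pm ct,e^{\frac{a\pm cb}2t}u).$$ The corresponding integrals $\int_{\mathbb{R}}T\,dx$ are, respectively, the generalized momentum $\tilde P=\int_{\mathbb{R}}e^{at}u_tu_x\,dx$, the generalized energy $$\tilde E=\int_{\mathbb{R}}\Big(\tfrac12e^{at}\big(u_t^2+c^2u_x^2+(2\tilde cu_x+au)u_t\big)+e^{\frac a2t}F(x-\tilde ct,e^{\frac a2t}u)\Big)dx,$$ and the generalized null energies $$\tilde E_\mp=\int_{\mathbb{R}}\Big(\tfrac12e^{at+bx}\big((u_t\mp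 cu_x)^2+(a\pm cb)(u_t+\tfrac14(a\pm3cb)u)u\big)+e^{\frac{a\pm3cb}2t+bx}F(x\pm ct,e^{\frac{a\pm cb}2t}u)\Big)dx.$$ Each is a conserved quantity: it does not depend on $t$ for every $C^2$ solution $u$ on $\mathbb{R}^2$ for which $T(t,\cdot)$ is integrable for each $t$ and the net flux $\Psi(t,R)-\Psi(t,-R)$ tends to $0$ as $R\to\infty$, locally uniformly in $t$. -/

import Mathlib

open scoped ContDiff

noncomputable section

namespace DampedWave

/-- A scalar field `u(t,x)` on the plane (first argument `t`, second argument `x`). -/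
abbrev Field := ℝ → ℝ → ℝ

/-- An expression that assigns to each field `u` a function of `(t,x)`, such as a multiplier, a
density or a flux. -/
abbrev FieldExpr := Field → Field

/-- The partial derivative with respect to `t`. -/
def dt (u : Field) : Field := fun t x => deriv (fun τ => u τ x) t

/-- The partial derivative with respect to `x`. -/
def dx (u : Field) : Field := fun t x => deriv (fun ξ => u t ξ) x

/-- Joint `C^m` regularity of a function of two real variables. -/
def IsC (m : WithTop ℕ∞) (u : ℝ → ℝ → ℝ) : Prop :=
  ContDiff ℝ m (fun z : ℝ × ℝ => u z.1 z.2)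

/-- Non-singularity of the term `g(t,x,u,u_t)`: it is jointly `C^m` on all of `ℝ⁴`. -/
def NonSingular (m : WithTop ℕ∞) (g : ℝ → ℝ → ℝ → ℝ → ℝ) : Prop :=
  ContDiff ℝ m (fun z : ℝ × ℝ × ℝ × ℝ => g z.1 z.2.1 z.2.2.1 z.2.2.2)

/-- `A` is a `C^m` differential function: a `C^m` function of `t`, `x`, and finitely many of
`u`, `u_t` and their `x`-derivatives. -/
def IsDiffFunction (m : WithTop ℕ∞) (A : FieldExpr) : Prop :=
  ∃ (k : ℕ) (φ : (ℝ × ℝ) × (Fin (k + 1) → ℝ) × (Fin (k + 1) → ℝ) → ℝ), ContDiff ℝ m φ ∧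
    ∀ u : Field, IsC ∞ u → ∀ t x : ℝ,
      A u t x = φ ((t, x), (fun i => (dx^[(i : ℕ)]) u t x), (fun i => (dx^[(i : ℕ)]) (dt u) t x))

/-- The wave expression `u_tt - c² u_xx + g(t,x,u,u_t)`. -/
def waveExpr (c : ℝ) (g : ℝ → ℝ → ℝ → ℝ → ℝ) : FieldExpr := fun u t x =>
  dt (dt u) t x - c ^ 2 * dx (dx u) t x + g t x (u t x) (dt u t x)

/-- `(T, Ψ)` is the density and flux of a local conservation law with multiplier `Q` for the wave
equation `u_tt + g = c² u_xx`: the divergence identity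
`(u_tt - c² u_xx + g) Q = D_t T + D_x Ψ` holds identically (that is, for all smooth fields `u`,
not only for solutions). -/
def IsConservationLaw (m : WithTop ℕ∞) (c : ℝ) (g : ℝ → ℝ → ℝ → ℝ → ℝ) (Q T Ψ : FieldExpr) : Prop :=
  IsDiffFunction m T ∧ IsDiffFunction m Ψ ∧
    ∀ u : Field, IsC ∞ u → ∀ t x : ℝ,
      waveExpr c g u t x * Q u t x = dt (T u) t x + dx (Ψ u) t x

/-- Local equivalence: `(T, Ψ)` and `(T', Ψ')` differ by a trivial conservation law
`(D_x Θ, -D_t Θ)`. -/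
def LocallyEquivalent (m : WithTop ℕ∞) (T Ψ T' Ψ' : FieldExpr) : Prop :=
  ∃ Θ : FieldExpr, IsDiffFunction m Θ ∧ ∀ u : Field, IsC ∞ u → ∀ t x : ℝ,
    T u t x - T' u t x = dx (Θ u) t x ∧ Ψ u t x - Ψ' u t x = -dt (Θ u) t x

/-- The energy-momentum multiplier `e^{at+bx} (c₁ u_t + c₂ u_x + c₀ u)`. -/
def linMultiplier (a b c₁ c₂ c₀ : ℝ) : FieldExpr := fun u t x =>
  Real.exp (a * t + b * x) * (c₁ * dt u t x + c₂ * dx u t x + c₀ * u t x)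

/-- The antiderivative `∫ f(y, κ u) du` in `u` (with `y`, `κ` held fixed), normalized to vanish at
`u = 0`. -/
def antideriv (f : ℝ → ℝ → ℝ) (y κ u : ℝ) : ℝ := ∫ s in (0 : ℝ)..u, f y (κ * s)

/-! Generalized momentum. -/

/-- `g = a u_t + f(t,u)`. -/
def momentumTerm (a : ℝ) (f : ℝ → ℝ → ℝ) : ℝ → ℝ → ℝ → ℝ → ℝ := fun t _ u p =>
  a * p + f t u

/-- `Q = e^{at} u_x`. -/
def momentumMultiplier (a : ℝ) : FieldExpr := fun u t x => Real.exp (a * t) * dx u t x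

/-- The density `e^{at} u_t u_x`. -/
def momentumDensity (a : ℝ) : FieldExpr := fun u t x => Real.exp (a * t) * dt u t x * dx u t x

/-- The flux `-e^{at} (u_t² + c² u_x²)/2 + e^{at} F(t,u)`, where `F = ∫ f du`. -/
def momentumFlux (c a : ℝ) (f : ℝ → ℝ → ℝ) : FieldExpr := fun u t x =>
  -Real.exp (a * t) * (1 / 2 * (dt u t x ^ 2 + c ^ 2 * dx u t x ^ 2))
    + Real.exp (a * t) * antideriv f t 1 (u t x)

/-! Generalized energy; `v` is the constant speed in the multiplier. -/

/-- `g = a u_t + f(x - v t, e^{at/2} u) e^{-at/2}`. -/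
def energyTerm (a v : ℝ) (f : ℝ → ℝ → ℝ) : ℝ → ℝ → ℝ → ℝ → ℝ := fun t x u p =>
  a * p + f (x - v * t) (Real.exp (a / 2 * t) * u) * Real.exp (-(a / 2 * t))

/-- `Q = e^{at} (u_t + v u_x + (a/2) u)`. -/
def energyMultiplier (a v : ℝ) : FieldExpr := fun u t x =>
  Real.exp (a * t) * (dt u t x + v * dx u t x + a / 2 * u t x)

/-- The density
`e^{at} ((u_t² + c² u_x²)/2 + (v u_x + a u/2) u_t) + e^{at/2} F(x - v t, e^{at/2} u)`. -/
def energyDensity (c a v : ℝ) (f : ℝ → ℝ → ℝ) : FieldExpr := fun u t x =>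
  Real.exp (a * t) * (1 / 2 * (dt u t x ^ 2 + c ^ 2 * dx u t x ^ 2)
      + (v * dx u t x + 1 / 2 * a * u t x) * dt u t x)
    + Real.exp (a / 2 * t) * antideriv f (x - v * t) (Real.exp (a / 2 * t)) (u t x)

/-- The flux
`-e^{at} (v (u_t² + c² u_x²)/2 + c² (u_t + a u/2) u_x) + v e^{at/2} F(x - v t, e^{at/2} u)`. -/
def energyFlux (c a v : ℝ) (f : ℝ → ℝ → ℝ) : FieldExpr := fun u t x =>
  -Real.exp (a * t) * (1 / 2 * v * (dt u t x ^ 2 + c ^ 2 * dx u t x ^ 2)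
      + c ^ 2 * (dt u t x + 1 / 2 * a * u t x) * dx u t x)
    + v * Real.exp (a / 2 * t) * antideriv f (x - v * t) (Real.exp (a / 2 * t)) (u t x)

/-! Generalized null energies; `s = 1` is the upper sign and `s = -1` the lower sign. -/

/-- `g = (a + s c b) u_t + (a + s c b)² u/4
      + f(x + s c t, e^{(a + s c b) t/2} u) e^{-(a - 3 s c b) t/2}`. -/
def nullTerm (c s a b : ℝ) (f : ℝ → ℝ → ℝ) : ℝ → ℝ → ℝ → ℝ → ℝ := fun t x u p =>
  (a + s * c * b) * p + 1 / 4 * (a + s * c * b) ^ 2 * u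
    + f (x + s * c * t) (Real.exp ((a + s * c * b) / 2 * t) * u)
      * Real.exp (-((a - 3 * s * c * b) / 2 * t))

/-- `Q = e^{at+bx} (u_t - s c u_x + (a + s c b) u/2)`. -/
def nullMultiplier (c s a b : ℝ) : FieldExpr := fun u t x =>
  Real.exp (a * t + b * x) * (dt u t x - s * c * dx u t x + (a + s * c * b) / 2 * u t x)

/-- The density `e^{at+bx} ((u_t - s c u_x)²/2 + (a + s c b)(u_t + (a + 3 s c b) u/4) u/2)
      + e^{(a + 3 s c b) t/2 + b x} F(x + s c t, e^{(a + s c b) t/2} u)`. -/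
def nullDensity (c s a b : ℝ) (f : ℝ → ℝ → ℝ) : FieldExpr := fun u t x =>
  Real.exp (a * t + b * x) * (1 / 2 * (dt u t x - s * c * dx u t x) ^ 2
      + 1 / 2 * (a + s * c * b) * (dt u t x + 1 / 4 * (a + 3 * s * c * b) * u t x) * u t x)
    + Real.exp ((a + 3 * s * c * b) / 2 * t + b * x)
      * antideriv f (x + s * c * t) (Real.exp ((a + s * c * b) / 2 * t)) (u t x)

/-- The flux `s c e^{at+bx} ((u_t - s c u_x)²/2 - (a + s c b)(s c u_x + (a - s c b) u/4) u/2)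
      - s c e^{(a + 3 s c b) t/2 + b x} F(x + s c t, e^{(a + s c b) t/2} u)`. -/
def nullFlux (c s a b : ℝ) (f : ℝ → ℝ → ℝ) : FieldExpr := fun u t x =>
  s * c * Real.exp (a * t + b * x) * (1 / 2 * (dt u t x - s * c * dx u t x) ^ 2
      - 1 / 2 * (a + s * c * b) * (s * c * dx u t x + 1 / 4 * (a - s * c * b) * u t x) * u t x)
    - s * c * Real.exp ((a + 3 * s * c * b) / 2 * t + b * x)
      * antideriv f (x + s * c * t) (Real.exp ((a + s * c * b) / 2 * t)) (u t x)

/-! Conserved integrals. -/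

/-- The integral `∫ T dx` over the real line at time `t`. -/
def consIntegral (T : FieldExpr) : Field → ℝ → ℝ := fun u t => ∫ x : ℝ, T u t x

/-- `u` is a (classical, `C²`) solution of `u_tt + g(t,x,u,u_t) = c² u_xx` on the plane. -/
def IsSolution (c : ℝ) (g : ℝ → ℝ → ℝ → ℝ → ℝ) (u : Field) : Prop :=
  IsC 2 u ∧ ∀ t x : ℝ, waveExpr c g u t x = 0

/-- `∫ T dx` is independent of `t` for every solution for which this integral converges and the net
spatial flux `Ψ` at `x = ±∞` vanishes (locally uniformly in `t`). -/
def IsConserved (c : ℝ) (g : ℝ → ℝ → ℝ → ℝ → ℝ) (T Ψ : FieldExpr) : Prop :=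
  ∀ u : Field, IsSolution c g u →
    (∀ t : ℝ, MeasureTheory.Integrable (fun x : ℝ => T u t x)) →
    TendstoLocallyUniformly (fun (R : ℝ) (t : ℝ) => Ψ u t R - Ψ u t (-R)) (fun _ => 0)
      Filter.atTop →
    ∀ t₁ t₂ : ℝ, consIntegral T u t₁ = consIntegral T u t₂

/-- The generalized momentum `∫ e^{at} u_t u_x dx`. -/
def genMomentum (a : ℝ) : Field → ℝ → ℝ := fun u t =>
  ∫ x : ℝ, Real.exp (a * t) * dt u t x * dx u t x

/-- The generalized energy `∫ (e^{at} (u_t² + c² u_x² + (2 v u_x + a u) u_t)/2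
      + e^{at/2} F(x - v t, e^{at/2} u)) dx`. -/
def genEnergy (c a v : ℝ) (f : ℝ → ℝ → ℝ) : Field → ℝ → ℝ := fun u t =>
  ∫ x : ℝ, (Real.exp (a * t) * (1 / 2)
      * (dt u t x ^ 2 + c ^ 2 * dx u t x ^ 2 + (2 * v * dx u t x + a * u t x) * dt u t x)
    + Real.exp (a / 2 * t) * antideriv f (x - v * t) (Real.exp (a / 2 * t)) (u t x))

/-- The generalized null energy
`∫ (e^{at+bx} ((u_t - s c u_x)² + (a + s c b)(u_t + (a + 3 s c b) u/4) u)/2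
      + e^{(a + 3 s c b) t/2 + b x} F(x + s c t, e^{(a + s c b) t/2} u)) dx`. -/
def genNullEnergy (c s a b : ℝ) (f : ℝ → ℝ → ℝ) : Field → ℝ → ℝ := fun u t =>
  ∫ x : ℝ, (Real.exp (a * t + b * x) * (1 / 2)
      * ((dt u t x - s * c * dx u t x) ^ 2
        + (a + s * c * b) * (dt u t x + 1 / 4 * (a + 3 * s * c * b) * u t x) * u t x)
    + Real.exp ((a + 3 * s * c * b) / 2 * t + b * x)
      * antideriv f (x + s * c * t) (Real.exp ((a + s * c * b) / 2 * t)) (u t x))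

end DampedWave

end

open DampedWave

/-!
A conservation law `W Q = D_t T + D_x Ψ`, where `W = u_tt - c² u_xx + g` and `Q` is linear in
`u_t, u_x, u`, says that `W Q` is a divergence. A change of the field with compact support then
does not change the integral of `W Q`, so that the Euler–Lagrange equation of `W Q` holds for every
smooth field (`integral_first_variation`, `euler_eq`). Only first and second derivatives of `u`
occur in it, and evaluation on quadratic polynomials turns it into an identity in the values of
`u, u_t, u_x, u_tt, u_tx, u_xx` at a point (`determining_eq`), affine in the second derivatives.
Its coefficients (`determining_system`) give `2 c₀ = a c₁ - b c₂` and two equations for `g_p`, the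
derivative of `g` in `u_t`. If `c₂ ≠ 0`, one of these says that `g_p` is constant; if `c₂ = 0`, the
other is `(p + a u / 2) g_pp = 2 (a - g_p)`, whose nonconstant solutions are singular at
`p = -a u / 2`. So `g_p` is constant because `g` has no singularities (`exists_partialP_eq`), and
then `c₁ = 0`, or `b = 0`, or `c₂ = ± c c₁`. What is left is a linear transport equation for
`g(t,x,u,0)`. Its solution along characteristics (`eq_of_transport`) gives one form of `g` for each
of the three cases (`classification`).

The multiplier determines the conservation law up to local equivalence, since every divergence-free
pair of differential functions is trivial: `(A, B) = (D_x Θ, -D_t Θ)`. This is `exists_potential`.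
The potential is an explicit integral rather than one from a homotopy formula for the variational
complex. By Green's formula, the integral of `A` over an interval depends only on the jets of the
field at the two ends (`integral_eq_of_eqJets`). Therefore `Θ` may be computed as the integral of
`A` over `[x - 1, x]` along a field that is zero near the left end and has the same jet as `u` at
`x`. No derivatives are lost, so `Θ` has the regularity of `A` and `B`.

Conversely, the three divergence identities are a computation with the primitive of `f`
(`momentum_identity`, `energy_identity`, `null_identity`). It requires only two derivatives of `u`,
and Green's formula on `[t₁, t₂] × [-R, R]`, with `R → ∞`, then gives conservation of the integrals
for `C²` solutions (`isConserved_of_firstOrder`).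
-/

namespace DampedWave

/-! ### Partial derivatives and jets of fields -/

section

variable {m n : WithTop ℕ∞} {u v : Field}

lemma two_le_infty : (2 : WithTop ℕ∞) ≤ ∞ := WithTop.coe_le_coe.2 le_top

lemma one_le_infty : (1 : WithTop ℕ∞) ≤ ∞ := WithTop.coe_le_coe.2 le_top

lemma IsC.of_le (hu : IsC n u) (h : m ≤ n) : IsC m u := ContDiff.of_le hu h

lemma IsC.continuous (hu : IsC n u) : Continuous fun z : ℝ × ℝ => u z.1 z.2 :=
  ContDiff.continuous hu

lemma IsC.differentiableAt (hu : IsC n u) (hn : 1 ≤ n) (z : ℝ × ℝ) :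
    DifferentiableAt ℝ (fun z : ℝ × ℝ => u z.1 z.2) z :=
  (ContDiff.differentiable hu (by positivity)) z

lemma IsC.hasDerivAt_fderiv_fst (hu : IsC n u) (hn : 1 ≤ n) (t x : ℝ) :
    HasDerivAt (fun τ => u τ x) (fderiv ℝ (fun z : ℝ × ℝ => u z.1 z.2) (t, x) (1, 0)) t :=
  HasFDerivAt.comp_hasDerivAt t (hu.differentiableAt hn (t, x)).hasFDerivAt
    (f := fun τ => (τ, x)) ((hasDerivAt_id t).prodMk (hasDerivAt_const t x))

lemma IsC.hasDerivAt_fderiv_snd (hu : IsC n u) (hn : 1 ≤ n) (t x : ℝ) :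
    HasDerivAt (fun ξ => u t ξ) (fderiv ℝ (fun z : ℝ × ℝ => u z.1 z.2) (t, x) (0, 1)) x :=
  (hu.differentiableAt hn (t, x)).hasFDerivAt.comp_hasDerivAt x
    ((hasDerivAt_const x t).prodMk (hasDerivAt_id x))

lemma IsC.dt_eq_fderiv (hu : IsC n u) (hn : 1 ≤ n) (t x : ℝ) :
    dt u t x = fderiv ℝ (fun z : ℝ × ℝ => u z.1 z.2) (t, x) (1, 0) :=
  (hu.hasDerivAt_fderiv_fst hn t x).deriv

lemma IsC.dx_eq_fderiv (hu : IsC n u) (hn : 1 ≤ n) (t x : ℝ) :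
    dx u t x = fderiv ℝ (fun z : ℝ × ℝ => u z.1 z.2) (t, x) (0, 1) :=
  (hu.hasDerivAt_fderiv_snd hn t x).deriv

lemma IsC.hasDerivAt_dt (hu : IsC n u) (hn : 1 ≤ n) (t x : ℝ) :
    HasDerivAt (fun τ => u τ x) (dt u t x) t := by
  rw [hu.dt_eq_fderiv hn]; exact hu.hasDerivAt_fderiv_fst hn t x

lemma IsC.hasDerivAt_dx (hu : IsC n u) (hn : 1 ≤ n) (t x : ℝ) :
    HasDerivAt (fun ξ => u t ξ) (dx u t x) x := by
  rw [hu.dx_eq_fderiv hn]; exact hu.hasDerivAt_fderiv_snd hn t x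

lemma IsC.dt (hu : IsC n u) (h : m + 1 ≤ n) : IsC m (dt u) := by
  have h1 : 1 ≤ n := le_trans (by simp) h
  have : (fun z : ℝ × ℝ => DampedWave.dt u z.1 z.2) =
      fun z => fderiv ℝ (fun z : ℝ × ℝ => u z.1 z.2) z (1, 0) := by
    funext z; exact hu.dt_eq_fderiv h1 z.1 z.2
  unfold IsC
  rw [this]
  exact (ContDiff.fderiv_right hu h).clm_apply contDiff_const

lemma IsC.dx (hu : IsC n u) (h : m + 1 ≤ n) : IsC m (dx u) := by
  have h1 : 1 ≤ n := le_trans (by simp) h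
  have : (fun z : ℝ × ℝ => DampedWave.dx u z.1 z.2) =
      fun z => fderiv ℝ (fun z : ℝ × ℝ => u z.1 z.2) z (0, 1) := by
    funext z; exact hu.dx_eq_fderiv h1 z.1 z.2
  unfold IsC
  rw [this]
  exact (ContDiff.fderiv_right hu h).clm_apply contDiff_const

/-- Equality of mixed partial derivatives. -/
lemma IsC.dt_dx_comm (hu : IsC n u) (h : 2 ≤ n) : DampedWave.dt (DampedWave.dx u) =
    DampedWave.dx (DampedWave.dt u) := by
  have h11 : (1 : WithTop ℕ∞) + 1 ≤ n := by rwa [one_add_one_eq_two]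
  have h1 : 1 ≤ n := le_trans (by simp) h11
  funext t x
  have hf : DifferentiableAt ℝ (fderiv ℝ (fun z : ℝ × ℝ => u z.1 z.2)) (t, x) :=
    ((ContDiff.fderiv_right hu h11).differentiable (by simp)) _
  have hs : IsSymmSndFDerivAt ℝ (fun z : ℝ × ℝ => u z.1 z.2) (t, x) :=
    (ContDiff.contDiffAt hu).isSymmSndFDerivAt (by simpa using h)
  have e1 : (fun z : ℝ × ℝ => DampedWave.dx u z.1 z.2) =
      fun z => fderiv ℝ (fun z : ℝ × ℝ => u z.1 z.2) z (0, 1) := by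
    funext z; exact hu.dx_eq_fderiv h1 z.1 z.2
  have e2 : (fun z : ℝ × ℝ => DampedWave.dt u z.1 z.2) =
      fun z => fderiv ℝ (fun z : ℝ × ℝ => u z.1 z.2) z (1, 0) := by
    funext z; exact hu.dt_eq_fderiv h1 z.1 z.2
  rw [(hu.dx h11).dt_eq_fderiv le_rfl, (hu.dt h11).dx_eq_fderiv le_rfl, e1, e2,
    fderiv_clm_apply hf (by fun_prop), fderiv_clm_apply hf (by fun_prop)]
  simpa using hs (1, 0) (0, 1)

lemma IsC.iterate_dx (hu : IsC ∞ u) (i : ℕ) : IsC ∞ (DampedWave.dx^[i] u) := by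
  induction i with
  | zero => exact hu
  | succ i ih => rw [Function.iterate_succ_apply']; exact ih.dx le_rfl

lemma IsC.dt_iterate_dx (hu : IsC ∞ u) (i : ℕ) :
    DampedWave.dt (DampedWave.dx^[i] u) = DampedWave.dx^[i] (DampedWave.dt u) := by
  induction i with
  | zero => rfl
  | succ i ih =>
    rw [Function.iterate_succ_apply', Function.iterate_succ_apply', ← ih,
      (hu.iterate_dx i).dt_dx_comm two_le_infty]

lemma iterate_dx_apply (i : ℕ) (u : Field) (t : ℝ) :
    (dx^[i] u) t = iteratedDeriv i (u t) := by
  induction i with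
  | zero => simp
  | succ i ih =>
    rw [Function.iterate_succ_apply', iteratedDeriv_succ, ← ih]
    rfl

lemma IsDiffFunction.isC {A : FieldExpr} (hA : IsDiffFunction m A) (hm : m ≤ ∞) (hu : IsC ∞ u) :
    IsC m (A u) := by
  obtain ⟨k, φ, hφ, h⟩ := hA
  have e : (fun z : ℝ × ℝ => A u z.1 z.2) = fun z => φ (z, fun i : Fin (k + 1) =>
      (dx^[(i : ℕ)]) u z.1 z.2,
      fun i : Fin (k + 1) => (dx^[(i : ℕ)]) (DampedWave.dt u) z.1 z.2) := by
    funext z; exact h u hu z.1 z.2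
  unfold IsC
  rw [e]
  have hu' : IsC ∞ (DampedWave.dt u) := hu.dt le_rfl
  exact hφ.comp (contDiff_id.prodMk
    ((contDiff_pi.2 fun i : Fin (k + 1) => (hu.iterate_dx i).of_le hm).prodMk
    (contDiff_pi.2 fun i : Fin (k + 1) => (hu'.iterate_dx i).of_le hm)))

/-- The fields `u` and `v` have the same `x`-jets of order `k` of `u` and `u_t` at `(t, x)`. -/
def EqJets (k : ℕ) (u v : Field) (t x : ℝ) : Prop :=
  (∀ i ≤ k, iteratedDeriv i (u t) x = iteratedDeriv i (v t) x) ∧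
    ∀ i ≤ k, iteratedDeriv i (dt u t) x = iteratedDeriv i (dt v t) x

lemma EqJets.mono {k l : ℕ} {t x : ℝ} (h : EqJets l u v t x) (hkl : k ≤ l) : EqJets k u v t x :=
  ⟨fun i hi => h.1 i (hi.trans hkl), fun i hi => h.2 i (hi.trans hkl)⟩

lemma EqJets.symm {k : ℕ} {t x : ℝ} (h : EqJets k u v t x) : EqJets k v u t x :=
  ⟨fun i hi => (h.1 i hi).symm, fun i hi => (h.2 i hi).symm⟩

lemma EqJets.trans {k : ℕ} {t x : ℝ} {w : Field} (h : EqJets k u v t x) (h' : EqJets k v w t x) :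
    EqJets k u w t x :=
  ⟨fun i hi => (h.1 i hi).trans (h'.1 i hi), fun i hi => (h.2 i hi).trans (h'.2 i hi)⟩

/-- Fields that agree on a strip `ξ ≈ x` have the same jets there. -/
lemma eqJets_of_eventually {t x : ℝ} (h : ∀ᶠ ξ in nhds x, ∀ τ, u τ ξ = v τ ξ) (k : ℕ) :
    EqJets k u v t x := by
  refine ⟨fun i _ => Filter.EventuallyEq.iteratedDeriv_eq i ?_,
    fun i _ => Filter.EventuallyEq.iteratedDeriv_eq i ?_⟩
  · filter_upwards [h] with ξ hξ using hξ t
  · filter_upwards [h] with ξ hξ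
    simp only [dt, hξ]

/-- The value of a differential function depends only on finitely many jets. -/
lemma IsDiffFunction.congr {A : FieldExpr} (hA : IsDiffFunction m A) : ∃ k : ℕ,
    ∀ ⦃u v : Field⦄, IsC ∞ u → IsC ∞ v → ∀ ⦃t x : ℝ⦄, EqJets k u v t x → A u t x = A v t x := by
  obtain ⟨k, φ, hφ, h⟩ := hA
  refine ⟨k, fun u v hu hv t x hj => ?_⟩
  rw [h u hu, h v hv]
  simp only [iterate_dx_apply]
  congr 3
  · funext i; exact hj.1 i (Nat.lt_succ_iff.1 i.2)
  · funext i; exact hj.2 i (Nat.lt_succ_iff.1 i.2)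

lemma IsDiffFunction.sub_smul {A B : FieldExpr} (hA : IsDiffFunction m A)
    (hB : IsDiffFunction m B) (r : ℝ) : IsDiffFunction m (A - r • B) := by
  obtain ⟨k, φ, hφ, h⟩ := hA
  obtain ⟨l, ψ, hψ, h'⟩ := hB
  let R (j : ℕ) (hj : j + 1 ≤ max k l + 1) (y : Fin (max k l + 1) → ℝ) : Fin (j + 1) → ℝ :=
    fun i => y (Fin.castLE hj i)
  have hk : k + 1 ≤ max k l + 1 := by simp
  have hl : l + 1 ≤ max k l + 1 := by simp
  have hR : ∀ j hj, ContDiff ℝ m (R j hj) := fun j hj => contDiff_pi.2 fun i => contDiff_apply ℝ ℝ _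
  refine ⟨max k l, fun y => φ (y.1, R k hk y.2.1, R k hk y.2.2)
    - r * ψ (y.1, R l hl y.2.1, R l hl y.2.2), ?_, fun u hu t x => ?_⟩
  · refine (hφ.comp (contDiff_fst.prodMk (((hR k hk).comp (by fun_prop)).prodMk
      ((hR k hk).comp (by fun_prop))))).sub (contDiff_const.mul
      (hψ.comp (contDiff_fst.prodMk (((hR l hl).comp (by fun_prop)).prodMk
      ((hR l hl).comp (by fun_prop))))))
  · change A u t x - r * B u t x = _
    rw [h u hu, h' u hu]
    rfl

end

/-! ### Integrals with parameters and Green's formula -/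

section

open MeasureTheory intervalIntegral Topology Filter

/-- Differentiation under the integral sign over a compact interval. -/
lemma hasFDerivAt_intervalIntegral_param {E F : Type} [NormedAddCommGroup E] [NormedSpace ℝ E]
    [FiniteDimensional ℝ E] [NormedAddCommGroup F] [NormedSpace ℝ F]
    {f : E × ℝ → F} (hf : ContDiff ℝ 1 f) (a b : ℝ) (x : E) :
    HasFDerivAt (fun x => ∫ s in a..b, f (x, s))
      (∫ s in a..b, (fderiv ℝ f (x, s)).comp (ContinuousLinearMap.inl ℝ E ℝ)) x := by
  let f' : E → ℝ → E →L[ℝ] F := fun x s => (fderiv ℝ f (x, s)).comp (ContinuousLinearMap.inl ℝ E ℝ)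
  have hf' : Continuous fun p : E × ℝ => f' p.1 p.2 :=
    (hf.continuous_fderiv (by simp)).clm_comp continuous_const
  obtain ⟨C, hC⟩ := ((isCompact_closedBall x 1).prod
    (isCompact_uIcc (a := a) (b := b))).exists_bound_of_continuousOn hf'.continuousOn
  refine intervalIntegral.hasFDerivAt_integral_of_dominated_of_fderiv_le (𝕜 := ℝ) (F' := f')
    (bound := fun _ => C) (Metric.ball_mem_nhds x one_pos) ?_ ?_ ?_ ?_ ?_ ?_
  · exact Eventually.of_forall fun y =>
      (hf.continuous.comp (by fun_prop : Continuous fun s => (y, s))).aestronglyMeasurable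
  · exact (hf.continuous.comp (by fun_prop : Continuous fun s => (x, s))).intervalIntegrable _ _
  · exact (hf'.comp (by fun_prop : Continuous fun s => (x, s))).aestronglyMeasurable
  · exact Eventually.of_forall fun s hs y hy =>
      hC (y, s) ⟨Metric.ball_subset_closedBall hy, Set.uIoc_subset_uIcc hs⟩
  · exact intervalIntegrable_const
  · refine Eventually.of_forall fun s hs y hy => ?_
    exact HasFDerivAt.comp (f := fun y => (y, s)) y
      ((hf.differentiable (by simp)) (y, s)).hasFDerivAt (hasFDerivAt_prodMk_left y s)

/-- An integral over a compact interval is as smooth in the parameters as its integrand. -/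
lemma contDiff_intervalIntegral_param {E : Type} [NormedAddCommGroup E] [NormedSpace ℝ E]
    [FiniteDimensional ℝ E] {F : Type} [NormedAddCommGroup F] [NormedSpace ℝ F] {m : ℕ∞}
    {f : E × ℝ → F} (hf : ContDiff ℝ m f) (a b : ℝ) :
    ContDiff ℝ m (fun x => ∫ s in a..b, f (x, s)) := by
  rw [contDiff_iff_forall_nat_le]
  intro n hn
  replace hf : ContDiff ℝ n f := hf.of_le (by exact_mod_cast hn)
  clear hn
  induction n generalizing F with
  | zero =>
    rw [Nat.cast_zero, contDiff_zero] at *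
    exact intervalIntegral.continuous_parametric_intervalIntegral_of_continuous'
      (f := fun x s => f (x, s)) hf a b
  | succ n ih =>
    push_cast at hf ⊢
    rw [contDiff_succ_iff_hasFDerivAt]
    have h1 : ContDiff ℝ 1 f := hf.of_le (by simp)
    refine ⟨_, ?_, fun x => hasFDerivAt_intervalIntegral_param h1 a b x⟩
    exact ih (f := fun p : E × ℝ => (fderiv ℝ f p).comp (ContinuousLinearMap.inl ℝ E ℝ))
      ((hf.fderiv_right le_rfl).clm_comp contDiff_const)

/-- A primitive is as smooth in the parameters and the upper limit as its integrand. -/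
lemma contDiff_primitive_param {E : Type} [NormedAddCommGroup E] [NormedSpace ℝ E]
    [FiniteDimensional ℝ E] {m : ℕ∞} {f : E × ℝ → ℝ} (hf : ContDiff ℝ m f) :
    ContDiff ℝ m (fun p : E × ℝ => ∫ s in (0 : ℝ)..p.2, f (p.1, s)) := by
  have e : (fun p : E × ℝ => ∫ s in (0 : ℝ)..p.2, f (p.1, s)) =
      fun p => p.2 * ∫ s in (0 : ℝ)..1, f (p.1, p.2 * s) := by
    funext p
    simp [intervalIntegral.mul_integral_comp_mul_left (f := fun s => f (p.1, s))]
  -- after rescaling to `[0, 1]` the upper limit is a parameter of the integrand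
  rw [e]
  exact contDiff_snd.mul (contDiff_intervalIntegral_param
    (f := fun q : (E × ℝ) × ℝ => f (q.1.1, q.1.2 * q.2)) (hf.comp (by fun_prop)) 0 1)

/-- Green's formula on a rectangle for a divergence-free pair. -/
lemma integral_sub_eq_of_divergence_eq_zero {T Ψ : Field} (hT : IsC 1 T) (hΨ : IsC 1 Ψ)
    (h : ∀ t x, dt T t x + dx Ψ t x = 0) (a b t₁ t₂ : ℝ) :
    (∫ x in a..b, T t₂ x) - ∫ x in a..b, T t₁ x =
      (∫ t in t₁..t₂, Ψ t a) - ∫ t in t₁..t₂, Ψ t b := by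
  have hd : ∀ z : ℝ × ℝ, fderiv ℝ (fun z : ℝ × ℝ => T z.1 z.2) z (1, 0) +
      fderiv ℝ (fun z : ℝ × ℝ => Ψ z.1 z.2) z (0, 1) = 0 := by
    intro z
    have := h z.1 z.2
    rwa [hT.dt_eq_fderiv le_rfl, hΨ.dx_eq_fderiv le_rfl] at this
  have := integral2_divergence_prod_of_hasFDerivAt (fun z : ℝ × ℝ => T z.1 z.2)
    (fun z : ℝ × ℝ => Ψ z.1 z.2) (fderiv ℝ fun z : ℝ × ℝ => T z.1 z.2)
    (fderiv ℝ fun z : ℝ × ℝ => Ψ z.1 z.2) t₁ a t₂ b hT.continuous.continuousOn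
    hΨ.continuous.continuousOn (fun z _ => (hT.differentiableAt le_rfl z).hasFDerivAt)
    (fun z _ => (hΨ.differentiableAt le_rfl z).hasFDerivAt) (by simp [hd])
  simp only [hd, intervalIntegral.integral_zero] at this
  linarith

end

/-! ### Divergence-free pairs of differential functions have a potential -/

section

open MeasureTheory intervalIntegral Topology Filter

variable {m : WithTop ℕ∞} {u v : Field}

lemma IsC.slice (hu : IsC m u) (t : ℝ) : ContDiff ℝ m (u t) :=
  ContDiff.comp (g := fun z : ℝ × ℝ => u z.1 z.2) hu (contDiff_const.prodMk contDiff_id)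

lemma IsC.slice_fst (hu : IsC m u) (x : ℝ) : ContDiff ℝ m (fun t => u t x) :=
  ContDiff.comp (g := fun z : ℝ × ℝ => u z.1 z.2) hu (contDiff_id.prodMk contDiff_const)

lemma iteratedDeriv_add_mul_sub {f g h : ℝ → ℝ} (hf : ContDiff ℝ ∞ f) (hg : ContDiff ℝ ∞ g)
    (hh : ContDiff ℝ ∞ h) (r : ℝ) (i : ℕ) (x : ℝ) :
    iteratedDeriv i (fun ξ => f ξ + r * (h ξ - g ξ)) x =
      iteratedDeriv i f x + r * (iteratedDeriv i h x - iteratedDeriv i g x) := by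
  have hi : (i : WithTop ℕ∞) ≤ ∞ := WithTop.coe_le_coe.2 le_top
  rw [iteratedDeriv_fun_add (hf.of_le hi).contDiffAt
    (contDiff_const.mul ((hh.sub hg).of_le hi)).contDiffAt, iteratedDeriv_const_mul_field,
    iteratedDeriv_fun_sub (hh.of_le hi).contDiffAt (hg.of_le hi).contDiffAt]

/-- For a divergence-free pair `(A, B)`, the integral of `A` over `[α, β]` at time `t` depends only
on the jets of the field at the two ends: a field can be switched from `u` to `v` in the past
without a change of the flux `B` through the ends. -/
lemma integral_eq_of_eqJets {A B : FieldExpr} (hA : IsDiffFunction m A) (hB : IsDiffFunction m B)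
    (h1 : 1 ≤ m) (hm : m ≤ ∞)
    (hdiv : ∀ u : Field, IsC ∞ u → ∀ t x, dt (A u) t x + dx (B u) t x = 0) {k : ℕ}
    (hk : ∀ ⦃u v : Field⦄, IsC ∞ u → IsC ∞ v → ∀ ⦃t x : ℝ⦄, EqJets k u v t x → B u t x = B v t x)
    (hu : IsC ∞ u) (hv : IsC ∞ v) {α β : ℝ} (hα : ∀ τ, EqJets k u v τ α)
    (hβ : ∀ τ, EqJets k u v τ β) (t : ℝ) :
    ∫ x in α..β, A u t x = ∫ x in α..β, A v t x := by
  obtain ⟨l, hl⟩ := hA.congr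
  -- `lam` is `0` before `t - 2` and `1` after `t - 1`, so that the field `w` below is `u` around
  -- the time `t - 3` and `v` around the time `t`
  set lam : ℝ → ℝ := fun τ => Real.smoothTransition (τ - t + 2) with hlam
  have hlamC : ContDiff ℝ ∞ lam := Real.smoothTransition.contDiff.comp (by fun_prop)
  set w : Field := fun τ ξ => u τ ξ + lam τ * (v τ ξ - u τ ξ) with hw
  have hwC : IsC ∞ w := ContDiff.add hu ((hlamC.comp contDiff_fst).mul (ContDiff.sub hv hu))
  have hdw : ∀ τ, dt w τ = fun ξ => (dt u τ ξ + deriv lam τ * (v τ ξ - u τ ξ))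
      + lam τ * (dt v τ ξ - dt u τ ξ) := by
    intro τ
    funext ξ
    have := (hu.hasDerivAt_dt one_le_infty τ ξ).add
      (((hlamC.differentiable (by simp)) τ).hasDerivAt.mul
      ((hv.hasDerivAt_dt one_le_infty τ ξ).sub (hu.hasDerivAt_dt one_le_infty τ ξ)))
    refine this.deriv.trans ?_
    simp only [Pi.sub_apply]
    ring
  have hu' := (hu.dt (m := ∞) le_rfl)
  have hv' := (hv.dt (m := ∞) le_rfl)
  -- the term `lam' (v - u)` of `w_t` does no harm where `u` and `v` have the same jets
  have key : ∀ τ x, EqJets k u v τ x → B w τ x = B u τ x := by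
    intro τ x hj
    refine hk hwC hu ⟨fun i hi => ?_, fun i hi => ?_⟩
    · rw [iteratedDeriv_add_mul_sub (hu.slice τ) (hu.slice τ) (hv.slice τ), hj.1 i hi]
      simp
    · rw [hdw, iteratedDeriv_add_mul_sub ((hu'.slice τ).add
        (contDiff_const.mul ((hv.slice τ).sub (hu.slice τ)))) (hu'.slice τ) (hv'.slice τ),
        iteratedDeriv_add_mul_sub (hu'.slice τ) (hu.slice τ) (hv.slice τ), hj.1 i hi, hj.2 i hi]
      simp
  have const : ∀ {s r : ℝ}, (∀ᶠ τ in 𝓝 s, lam τ = r) → lam s = r ∧ deriv lam s = 0 := by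
    intro s r hs
    refine ⟨hs.self_of_nhds, ?_⟩
    rw [(show lam =ᶠ[𝓝 s] fun _ => r from hs).deriv_eq, deriv_const]
  have past : lam (t - 3) = 0 ∧ deriv lam (t - 3) = 0 := by
    refine const ?_
    filter_upwards [Iio_mem_nhds (show t - 3 < t - 2 by linarith)] with τ hτ
    exact Real.smoothTransition.zero_of_nonpos (by simp only [Set.mem_Iio] at hτ; linarith)
  have now : lam t = 1 ∧ deriv lam t = 0 := by
    refine const ?_
    filter_upwards [Ioi_mem_nhds (show t - 1 < t by linarith)] with τ hτ
    exact Real.smoothTransition.one_of_one_le (by simp only [Set.mem_Ioi] at hτ; linarith)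
  have e1 : ∀ x, A w (t - 3) x = A u (t - 3) x := by
    intro x
    refine hl hwC hu ⟨fun i _ => ?_, fun i _ => ?_⟩
    · simp only [hw, past.1]; simp
    · rw [hdw, past.1, past.2]; simp
  have e2 : ∀ x, A w t x = A v t x := by
    intro x
    refine hl hwC hv ⟨fun i _ => ?_, fun i _ => ?_⟩
    · simp only [hw, now.1]; simp
    · rw [hdw, now.1, now.2]; simp
  have gw := integral_sub_eq_of_divergence_eq_zero ((hA.isC hm hwC).of_le h1)
    ((hB.isC hm hwC).of_le h1) (hdiv w hwC) α β (t - 3) t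
  have gu := integral_sub_eq_of_divergence_eq_zero ((hA.isC hm hu).of_le h1)
    ((hB.isC hm hu).of_le h1) (hdiv u hu) α β (t - 3) t
  simp only [key _ _ (hα _), key _ _ (hβ _), e1, e2] at gw
  linarith

/-- A smooth cutoff, equal to `1` on `[-1/4, ∞)` and to `0` on `(-∞, -3/4]`. -/
noncomputable def cutoff (s : ℝ) : ℝ := Real.smoothTransition (2 * s + 3 / 2)

lemma contDiff_cutoff : ContDiff ℝ ∞ cutoff :=
  Real.smoothTransition.contDiff.comp (by fun_prop)

lemma cutoff_eq_one {s : ℝ} (h : -1 / 4 ≤ s) : cutoff s = 1 :=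
  Real.smoothTransition.one_of_one_le (by linarith)

lemma cutoff_eq_zero {s : ℝ} (h : s ≤ -3 / 4) : cutoff s = 0 :=
  Real.smoothTransition.zero_of_nonpos (by linarith)

/-- The monomial `s^j / j!`, cut off away from the origin on the left. -/
noncomputable def cutMonomial (j : ℕ) (s : ℝ) : ℝ := cutoff s * (s ^ j / j.factorial)

lemma contDiff_cutMonomial (j : ℕ) : ContDiff ℝ ∞ (cutMonomial j) :=
  contDiff_cutoff.mul (by fun_prop)

lemma iteratedDeriv_cutMonomial_zero (i j : ℕ) :
    iteratedDeriv i (cutMonomial j) 0 = if i = j then 1 else 0 := by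
  have : cutMonomial j =ᶠ[𝓝 0] fun s => s ^ j / j.factorial := by
    filter_upwards [Ioi_mem_nhds (show (-1 / 4 : ℝ) < 0 by norm_num)] with s hs
    rw [cutMonomial, cutoff_eq_one (le_of_lt hs), one_mul]
  rw [this.iteratedDeriv_eq, iteratedDeriv_div_const, iteratedDeriv_fun_pow_zero]
  split_ifs with h
  · exact div_self (by exact_mod_cast j.factorial_ne_zero)
  · simp

/-- The field that has, for each `τ`, the same `x`-jet of order `k` as `u` at `(τ, x)`, and that
vanishes for `ξ ≤ x - 3/4`. -/
noncomputable def cutTaylor (k : ℕ) (u : Field) (x : ℝ) : Field := fun τ ξ =>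
  ∑ j : Fin (k + 1), (dx^[(j : ℕ)] u) τ x * cutMonomial j (ξ - x)

lemma isC_cutTaylor (k : ℕ) (hu : IsC ∞ u) (x : ℝ) : IsC ∞ (cutTaylor k u x) :=
  ContDiff.sum fun j _ => (((hu.iterate_dx j).slice_fst x).comp contDiff_fst).mul
    ((contDiff_cutMonomial j).comp (by fun_prop))

lemma dt_cutTaylor (k : ℕ) (hu : IsC ∞ u) (x : ℝ) :
    dt (cutTaylor k u x) = cutTaylor k (dt u) x := by
  funext τ ξ
  simp only [cutTaylor, ← hu.dt_iterate_dx]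
  exact (HasDerivAt.fun_sum (u := Finset.univ) fun (j : Fin (k + 1)) _ =>
    ((hu.iterate_dx j).hasDerivAt_dt one_le_infty τ x).mul_const (cutMonomial j (ξ - x))).deriv

lemma iteratedDeriv_cutTaylor (k : ℕ) (u : Field) (τ x ξ : ℝ) (i : ℕ) :
    iteratedDeriv i (cutTaylor k u x τ) ξ =
      ∑ j : Fin (k + 1), (dx^[(j : ℕ)] u) τ x * iteratedDeriv i (cutMonomial j) (ξ - x) := by
  have hi : (i : WithTop ℕ∞) ≤ ∞ := WithTop.coe_le_coe.2 le_top
  have hc : ∀ j : ℕ, ContDiff ℝ ∞ fun ξ => cutMonomial j (ξ - x) := fun j =>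
    (contDiff_cutMonomial j).comp (by fun_prop)
  unfold cutTaylor
  rw [iteratedDeriv_fun_sum fun (j : Fin (k + 1)) _ =>
    (((contDiff_const (c := (dx^[(j : ℕ)] u) τ x)).mul (hc j)).of_le hi).contDiffAt]
  refine Finset.sum_congr rfl fun j _ => ?_
  rw [iteratedDeriv_const_mul_field]
  congr 1
  exact congrFun (iteratedDeriv_comp_sub_const i (cutMonomial j) x) ξ

lemma iteratedDeriv_cutTaylor_self (k : ℕ) (u : Field) (τ x : ℝ) {i : ℕ} (hi : i ≤ k) :
    iteratedDeriv i (cutTaylor k u x τ) x = iteratedDeriv i (u τ) x := by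
  rw [iteratedDeriv_cutTaylor, Finset.sum_eq_single ⟨i, Nat.lt_succ_iff.2 hi⟩]
  · simp [iteratedDeriv_cutMonomial_zero, iterate_dx_apply]
  · intro j _ hj
    rw [sub_self, iteratedDeriv_cutMonomial_zero, if_neg, mul_zero]
    exact fun h => hj (Fin.ext h.symm)
  · simp

lemma eqJets_cutTaylor_self (k : ℕ) (hu : IsC ∞ u) (τ x : ℝ) :
    EqJets k (cutTaylor k u x) u τ x := by
  refine ⟨fun i hi => iteratedDeriv_cutTaylor_self k u τ x hi, fun i hi => ?_⟩
  rw [dt_cutTaylor k hu]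
  exact iteratedDeriv_cutTaylor_self k _ τ x hi

lemma isC_zero : IsC m (0 : Field) := contDiff_const

lemma eqJets_cutTaylor_sub_one (k : ℕ) (u : Field) (τ x : ℝ) :
    EqJets k (cutTaylor k u x) 0 τ (x - 1) := by
  refine eqJets_of_eventually ?_ k
  filter_upwards [Iio_mem_nhds (show x - 1 < x - 3 / 4 by linarith)] with ξ hξ τ
  refine Finset.sum_eq_zero fun j _ => ?_
  rw [cutMonomial, cutoff_eq_zero, zero_mul, mul_zero]
  simp only [Set.mem_Iio] at hξ
  linarith

lemma integral_hasDerivAt_endpoint {f : ℝ → ℝ} (hf : Continuous f) (x : ℝ) :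
    HasDerivAt (fun y => ∫ ξ in (y - 1)..y, f ξ) (f x - f (x - 1)) x := by
  have h : ∀ y, ∫ ξ in (y - 1)..y, f ξ = (∫ ξ in (0 : ℝ)..y, f ξ) - ∫ ξ in (0 : ℝ)..(y - 1), f ξ :=
    fun y => (integral_interval_sub_left (hf.intervalIntegrable _ _)
      (hf.intervalIntegrable _ _)).symm
  simp only [h]
  have h1 : HasDerivAt (fun y => ∫ ξ in (0 : ℝ)..y, f ξ) (f x) x :=
    hf.integral_hasStrictDerivAt 0 x |>.hasDerivAt
  have h2 : HasDerivAt (fun y => ∫ ξ in (0 : ℝ)..y, f ξ) (f (x - 1)) (x - 1) :=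
    hf.integral_hasStrictDerivAt 0 (x - 1) |>.hasDerivAt
  exact h1.sub (HasDerivAt.comp_sub_const x 1 h2)

/-- Every divergence-free pair `(A, B)` of differential functions is of the form
`(D_x Θ, -D_t Θ)`. Here `Θ` at `(t, x)` is the integral of `A` over `[x - 1, x]` along the cut-off
Taylor polynomial of the field at `x`, plus a correction by the potential of the pair on the zero
field. As a function of jets this is as smooth as `A`, because the field enters the integrand only
through its jet at `x`. -/
theorem exists_potential {m : ℕ∞} {A B : FieldExpr} (h1 : 1 ≤ m) (hA : IsDiffFunction m A)
    (hB : IsDiffFunction m B)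
    (hdiv : ∀ u : Field, IsC ∞ u → ∀ t x, dt (A u) t x + dx (B u) t x = 0) :
    ∃ Θ : FieldExpr, IsDiffFunction m Θ ∧ ∀ u : Field, IsC ∞ u → ∀ t x,
      A u t x = dx (Θ u) t x ∧ B u t x = -dt (Θ u) t x := by
  have hm : (m : WithTop ℕ∞) ≤ ∞ := WithTop.coe_le_coe.2 le_top
  have h1' : (1 : WithTop ℕ∞) ≤ m := by exact_mod_cast h1
  obtain ⟨k₁, hk₁⟩ := hA.congr
  obtain ⟨k₂, hk₂⟩ := hB.congr
  set k := max k₁ k₂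
  have hkA : ∀ ⦃u v : Field⦄, IsC ∞ u → IsC ∞ v → ∀ ⦃t x : ℝ⦄, EqJets k u v t x →
      A u t x = A v t x := fun u v hu hv t x h => hk₁ hu hv (h.mono (le_max_left _ _))
  have hkB : ∀ ⦃u v : Field⦄, IsC ∞ u → IsC ∞ v → ∀ ⦃t x : ℝ⦄, EqJets k u v t x →
      B u t x = B v t x := fun u v hu hv t x h => hk₂ hu hv (h.mono (le_max_right _ _))
  have cA : ∀ {u : Field}, IsC ∞ u → IsC m (A u) := fun hu => hA.isC hm hu
  have cB : ∀ {u : Field}, IsC ∞ u → IsC m (B u) := fun hu => hB.isC hm hu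
  have green : ∀ {u : Field}, IsC ∞ u → ∀ a b t₁ t₂,
      (∫ x in a..b, A u t₂ x) - ∫ x in a..b, A u t₁ x =
      (∫ t in t₁..t₂, B u t a) - ∫ t in t₁..t₂, B u t b := fun hu =>
    integral_sub_eq_of_divergence_eq_zero ((cA hu).of_le h1') ((cB hu).of_le h1') (hdiv _ hu)
  have z : IsC ∞ (0 : Field) := isC_zero
  -- a potential of the pair evaluated on the zero field
  set θ : ℝ → ℝ → ℝ := fun t x => (∫ ξ in (0 : ℝ)..x, A 0 t ξ) - ∫ τ in (0 : ℝ)..t, B 0 τ 0 with hθ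
  have hθx : ∀ t x, HasDerivAt (fun y => θ t y) (A 0 t x) x := fun t x =>
    (((cA z).slice t).continuous.integral_hasStrictDerivAt 0 x).hasDerivAt.sub_const _
  have hθt : ∀ t x, HasDerivAt (fun τ => θ τ x) (-B 0 t x) t := by
    intro t x
    have e : ∀ τ, θ τ x = (∫ ξ in (0 : ℝ)..x, A 0 0 ξ) - ∫ s in (0 : ℝ)..τ, B 0 s x := by
      intro τ
      have := green z 0 x 0 τ
      simp only [hθ]
      linarith
    simp only [e]
    exact ((((cB z).slice_fst x).continuous.integral_hasStrictDerivAt 0 t).hasDerivAt).const_sub _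
  refine ⟨fun u t x => θ t (x - 1) + ∫ ξ in (x - 1)..x, A (cutTaylor k u x) t ξ, ?_, ?_⟩
  · obtain ⟨l, φ, hφ, hrep⟩ := id hA
    -- the jet of order `l` at `x + s` of the cut-off Taylor polynomial with coefficients `y` at `x`
    let J (s : ℝ) (y : Fin (k + 1) → ℝ) : Fin (l + 1) → ℝ := fun i =>
      ∑ j : Fin (k + 1), y j * iteratedDeriv i (cutMonomial j) s
    have hJ : ContDiff ℝ m fun p : ℝ × (Fin (k + 1) → ℝ) => J p.1 p.2 := by
      refine contDiff_pi.2 fun i => ContDiff.sum fun j _ => ContDiff.mul (by fun_prop) ?_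
      have : ContDiff ℝ ∞ (iteratedDeriv i (cutMonomial j)) := by
        rw [iteratedDeriv_eq_iterate]
        exact (contDiff_cutMonomial j).iterate_deriv i
      exact (this.of_le hm).comp contDiff_fst
    have hθC : ContDiff ℝ m fun p : ℝ × ℝ => θ p.1 p.2 :=
      (contDiff_primitive_param (f := fun p : ℝ × ℝ => A 0 p.1 p.2) (cA z)).sub
        ((contDiff_primitive_param (E := ℝ) (f := fun p : ℝ × ℝ => B 0 p.2 0)
          (((cB z).slice_fst 0).comp contDiff_snd)).comp (contDiff_snd.prodMk contDiff_fst))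
    refine ⟨k, fun p => θ p.1.1 (p.1.2 - 1) + ∫ s in (-1 : ℝ)..0,
      φ ((p.1.1, p.1.2 + s), J s p.2.1, J s p.2.2), ?_, fun u hu t x => ?_⟩
    · refine (hθC.comp (f := fun p : (ℝ × ℝ) × (Fin (k + 1) → ℝ) × (Fin (k + 1) → ℝ) =>
        (p.1.1, p.1.2 - 1)) (by fun_prop)).add (contDiff_intervalIntegral_param
        (f := fun q : ((ℝ × ℝ) × (Fin (k + 1) → ℝ) × (Fin (k + 1) → ℝ)) × ℝ =>
          φ ((q.1.1.1, q.1.1.2 + q.2), J q.2 q.1.2.1, J q.2 q.1.2.2)) ?_ (-1) 0)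
      refine hφ.comp (ContDiff.prodMk (by fun_prop) (ContDiff.prodMk ?_ ?_))
      · exact hJ.comp (f := fun q : ((ℝ × ℝ) × (Fin (k + 1) → ℝ) × (Fin (k + 1) → ℝ)) × ℝ =>
          (q.2, q.1.2.1)) (by fun_prop)
      · exact hJ.comp (f := fun q : ((ℝ × ℝ) × (Fin (k + 1) → ℝ) × (Fin (k + 1) → ℝ)) × ℝ =>
          (q.2, q.1.2.2)) (by fun_prop)
    · have shift := intervalIntegral.integral_comp_add_left
        (fun ξ => A (cutTaylor k u x) t ξ) x (a := -1) (b := 0)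
      rw [add_zero, ← sub_eq_add_neg] at shift
      beta_reduce
      rw [← shift]
      congr 1
      refine intervalIntegral.integral_congr fun s _ => ?_
      simp only
      rw [hrep _ (isC_cutTaylor k hu x), dt_cutTaylor k hu]
      simp only [iterate_dx_apply, iteratedDeriv_cutTaylor, add_sub_cancel_left, J]
  · intro u hu t x
    have hc : ∀ y, IsC ∞ (cutTaylor k u y) := isC_cutTaylor k hu
    -- the `t`-derivative: Green's formula for the field `cutTaylor k u x`, with `x` fixed
    have ct : HasDerivAt (fun τ => ∫ ξ in (x - 1)..x, A (cutTaylor k u x) τ ξ)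
        (B 0 t (x - 1) - B u t x) t := by
      have e : ∀ τ, ∫ ξ in (x - 1)..x, A (cutTaylor k u x) τ ξ =
          (∫ ξ in (x - 1)..x, A (cutTaylor k u x) 0 ξ) + ((∫ s in (0 : ℝ)..τ, B 0 s (x - 1)) -
            ∫ s in (0 : ℝ)..τ, B u s x) := by
        intro τ
        have := green (hc x) (x - 1) x 0 τ
        simp only [hkB (hc x) z (eqJets_cutTaylor_sub_one k u _ x),
          hkB (hc x) hu (eqJets_cutTaylor_self k hu _ x)] at this
        linarith
      rw [funext e]
      exact ((((cB z).slice_fst (x - 1)).continuous.integral_hasStrictDerivAt 0 t).hasDerivAt.sub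
        (((cB hu).slice_fst x).continuous.integral_hasStrictDerivAt 0 t).hasDerivAt).const_add _
    -- the `x`-derivative: by `integral_eq_of_eqJets` only the jets at the two ends matter
    have cx : HasDerivAt (fun y => ∫ ξ in (y - 1)..y, A (cutTaylor k u y) t ξ)
        (A u t x - A 0 t (x - 1)) x := by
      -- near `x` all the fields `cutTaylor k u y` may be replaced by one field, independent of `y`
      set w : Field := fun τ ξ => cutoff (ξ - x) * u τ ξ with hw
      have hwC : IsC ∞ w := ContDiff.mul (contDiff_cutoff.comp (by fun_prop)) hu
      have hwu : ∀ y τ, |y - x| < 1 / 4 → EqJets k w u τ y := by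
        intro y τ hy
        refine eqJets_of_eventually ?_ k
        filter_upwards [Ioi_mem_nhds (show x - 1 / 4 < y by linarith [(abs_lt.1 hy).1])]
          with ξ hξ τ
        simp only [Set.mem_Ioi] at hξ
        rw [hw]; simp only
        rw [cutoff_eq_one (by linarith), one_mul]
      have hw0 : ∀ y τ, |y - x| < 1 / 4 → EqJets k w 0 τ (y - 1) := by
        intro y τ hy
        refine eqJets_of_eventually ?_ k
        filter_upwards [Iio_mem_nhds (show y - 1 < x - 3 / 4 by linarith [(abs_lt.1 hy).2])]
          with ξ hξ τ
        simp only [Set.mem_Iio] at hξ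
        rw [hw]; simp only
        rw [cutoff_eq_zero (by linarith), zero_mul]; rfl
      have h0 : |x - x| < 1 / 4 := by simp
      have e : (fun y => ∫ ξ in (y - 1)..y, A (cutTaylor k u y) t ξ) =ᶠ[𝓝 x]
          fun y => ∫ ξ in (y - 1)..y, A w t ξ := by
        filter_upwards [Metric.ball_mem_nhds x (show (0 : ℝ) < 1 / 4 by norm_num)] with y hy
        rw [Metric.mem_ball, Real.dist_eq] at hy
        exact integral_eq_of_eqJets hA hB h1' hm hdiv hkB (hc y) hwC
          (fun τ => (eqJets_cutTaylor_sub_one k u τ y).trans (hw0 y τ hy).symm)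
          (fun τ => (eqJets_cutTaylor_self k hu τ y).trans (hwu y τ hy).symm) t
      have := integral_hasDerivAt_endpoint ((cA hwC).slice t).continuous x
      rw [hkA hwC hu (hwu x t h0), hkA hwC z (hw0 x t h0)] at this
      exact this.congr_of_eventuallyEq e
    constructor
    · have := ((hθx t (x - 1)).comp_sub_const x 1).add cx
      refine Eq.trans ?_ this.deriv.symm
      ring
    · have := (hθt t (x - 1)).add ct
      refine Eq.trans ?_ (congrArg Neg.neg this.deriv.symm)
      ring

end

/-! ### The first variation of a divergence -/

section

open MeasureTheory Topology Filter

variable {m n : WithTop ℕ∞} {u v : Field}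

/-- The topological support of a field, as a subset of the plane. -/
def fieldSupport (u : Field) : Set (ℝ × ℝ) := tsupport fun z : ℝ × ℝ => u z.1 z.2

lemma eq_zero_of_notMem_fieldSupport {t x : ℝ} (h : (t, x) ∉ fieldSupport u) : u t x = 0 :=
  image_eq_zero_of_notMem_tsupport (f := fun z : ℝ × ℝ => u z.1 z.2) h

lemma fieldSupport_dt (hu : IsC n u) (hn : 1 ≤ n) : fieldSupport (dt u) ⊆ fieldSupport u := by
  refine closure_minimal (fun z hz => ?_) (isClosed_tsupport _)
  by_contra h
  refine hz ?_
  simp only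
  rw [hu.dt_eq_fderiv hn,
    image_eq_zero_of_notMem_tsupport fun h' => h (tsupport_fderiv_subset ℝ h')]
  rfl

lemma fieldSupport_dx (hu : IsC n u) (hn : 1 ≤ n) : fieldSupport (dx u) ⊆ fieldSupport u := by
  refine closure_minimal (fun z hz => ?_) (isClosed_tsupport _)
  by_contra h
  refine hz ?_
  simp only
  rw [hu.dx_eq_fderiv hn,
    image_eq_zero_of_notMem_tsupport fun h' => h (tsupport_fderiv_subset ℝ h')]
  rfl

/-- A test field: smooth with compact support. -/
structure IsTest (φ : Field) : Prop where
  smooth : IsC ∞ φ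
  compact : IsCompact (fieldSupport φ)

lemma IsTest.dt {φ : Field} (h : IsTest φ) : IsTest (dt φ) :=
  ⟨h.smooth.dt le_rfl, h.compact.of_isClosed_subset (isClosed_tsupport _)
    (fieldSupport_dt h.smooth one_le_infty)⟩

lemma IsTest.dx {φ : Field} (h : IsTest φ) : IsTest (dx φ) :=
  ⟨h.smooth.dx le_rfl, h.compact.of_isClosed_subset (isClosed_tsupport _)
    (fieldSupport_dx h.smooth one_le_infty)⟩

lemma integrable_mul_of_isCompact (hu : IsC 0 u) (hv : IsC 0 v) (hc : IsCompact (fieldSupport v)) :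
    Integrable fun z : ℝ × ℝ => u z.1 z.2 * v z.1 z.2 :=
  (hu.continuous.mul hv.continuous).integrable_of_hasCompactSupport
    (HasCompactSupport.mul_left (f' := fun z : ℝ × ℝ => v z.1 z.2) hc)

lemma integral_mul_dt (hu : IsC 1 u) (hv : IsC 1 v) (hc : IsCompact (fieldSupport v)) :
    ∫ z : ℝ × ℝ, u z.1 z.2 * dt v z.1 z.2 = -∫ z : ℝ × ℝ, dt u z.1 z.2 * v z.1 z.2 := by
  have i1 := integrable_mul_of_isCompact (hu.dt (m := 0) le_rfl) (hv.of_le zero_le_one) hc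
  have i2 := integrable_mul_of_isCompact (hu.of_le zero_le_one) (hv.dt (m := 0) le_rfl)
    (hc.of_isClosed_subset (isClosed_tsupport _) (fieldSupport_dt hv le_rfl))
  have i3 := integrable_mul_of_isCompact (hu.of_le zero_le_one) (hv.of_le zero_le_one) hc
  simp only [hu.dt_eq_fderiv le_rfl, hv.dt_eq_fderiv le_rfl] at i1 i2 ⊢
  exact integral_mul_fderiv_eq_neg_fderiv_mul_of_integrable i1 i2 i3
    (fun z _ => hu.differentiableAt le_rfl z) (fun z _ => hv.differentiableAt le_rfl z)

lemma integral_mul_dx (hu : IsC 1 u) (hv : IsC 1 v) (hc : IsCompact (fieldSupport v)) :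
    ∫ z : ℝ × ℝ, u z.1 z.2 * dx v z.1 z.2 = -∫ z : ℝ × ℝ, dx u z.1 z.2 * v z.1 z.2 := by
  have i1 := integrable_mul_of_isCompact (hu.dx (m := 0) le_rfl) (hv.of_le zero_le_one) hc
  have i2 := integrable_mul_of_isCompact (hu.of_le zero_le_one) (hv.dx (m := 0) le_rfl)
    (hc.of_isClosed_subset (isClosed_tsupport _) (fieldSupport_dx hv le_rfl))
  have i3 := integrable_mul_of_isCompact (hu.of_le zero_le_one) (hv.of_le zero_le_one) hc
  simp only [hu.dx_eq_fderiv le_rfl, hv.dx_eq_fderiv le_rfl] at i1 i2 ⊢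
  exact integral_mul_fderiv_eq_neg_fderiv_mul_of_integrable i1 i2 i3
    (fun z _ => hu.differentiableAt le_rfl z) (fun z _ => hv.differentiableAt le_rfl z)

lemma integral_dt_eq_zero (hv : IsC 1 v) (hc : IsCompact (fieldSupport v)) :
    ∫ z : ℝ × ℝ, dt v z.1 z.2 = 0 := by
  have := integral_mul_dt (u := fun _ _ => 1) contDiff_const hv hc
  simpa [dt] using this

lemma integral_dx_eq_zero (hv : IsC 1 v) (hc : IsCompact (fieldSupport v)) :
    ∫ z : ℝ × ℝ, dx v z.1 z.2 = 0 := by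
  have := integral_mul_dx (u := fun _ _ => 1) contDiff_const hv hc
  simpa [dx] using this

lemma integral_combination {f₁ f₂ f₃ f₄ f₅ : ℝ × ℝ → ℝ} (h₁ : Integrable f₁) (h₂ : Integrable f₂)
    (h₃ : Integrable f₃) (h₄ : Integrable f₄) (h₅ : Integrable f₅) (r : ℝ) :
    ∫ z, (f₁ z - r * f₂ z + f₃ z + f₄ z + f₅ z) =
      (∫ z, f₁ z) - r * (∫ z, f₂ z) + (∫ z, f₃ z) + (∫ z, f₄ z) + ∫ z, f₅ z := by
  have h₂' := h₂.const_mul r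
  rw [integral_add, integral_add, integral_add, integral_sub, integral_const_mul]
  exacts [h₁, h₂', h₁.sub h₂', h₃, (h₁.sub h₂').add h₃, h₄, ((h₁.sub h₂').add h₃).add h₄, h₅]

/-- The fundamental lemma of the calculus of variations, for a first variation of second order. -/
lemma euler_eq_of_integral_eq_zero {c : ℝ} {a b₀ b₁ b₂ : Field} (ha : IsC 2 a) (h0 : IsC 0 b₀)
    (h1 : IsC 1 b₁) (h2 : IsC 1 b₂)
    (h : ∀ φ : Field, IsTest φ → ∫ z : ℝ × ℝ, (a z.1 z.2 * dt (dt φ) z.1 z.2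
      - c ^ 2 * (a z.1 z.2 * dx (dx φ) z.1 z.2) + b₁ z.1 z.2 * dt φ z.1 z.2
      + b₂ z.1 z.2 * dx φ z.1 z.2 + b₀ z.1 z.2 * φ z.1 z.2) = 0) (t x : ℝ) :
    dt (dt a) t x - c ^ 2 * dx (dx a) t x - dt b₁ t x - dx b₂ t x + b₀ t x = 0 := by
  have h11 : (1 : WithTop ℕ∞) + 1 ≤ 2 := by rw [one_add_one_eq_two]
  have a1 : IsC 1 a := ha.of_le one_le_two
  have a0 : IsC 0 a := ha.of_le zero_le_two
  have cat : IsC 0 (dt (dt a)) := (ha.dt h11).dt le_rfl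
  have cax : IsC 0 (dx (dx a)) := (ha.dx h11).dx le_rfl
  have cb1 : IsC 0 (dt b₁) := h1.dt le_rfl
  have cb2 : IsC 0 (dx b₂) := h2.dx le_rfl
  let R : ℝ × ℝ → ℝ := fun z => dt (dt a) z.1 z.2 - c ^ 2 * dx (dx a) z.1 z.2 - dt b₁ z.1 z.2
    - dx b₂ z.1 z.2 + b₀ z.1 z.2
  have hR : Continuous R := (((cat.continuous.sub (continuous_const.mul cax.continuous)).sub
    cb1.continuous).sub cb2.continuous).add h0.continuous
  have key : ∀ᵐ z : ℝ × ℝ, R z = 0 := by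
    refine ae_eq_zero_of_integral_contDiff_smul_eq_zero hR.locallyIntegrable fun φ hφ hc => ?_
    let f : Field := fun t x => φ (t, x)
    have hf : IsTest f := ⟨hφ, hc⟩
    have e := h f hf
    have f1 : IsC 1 f := hf.smooth.of_le one_le_infty
    have ft1 : IsC 1 (dt f) := hf.dt.smooth.of_le one_le_infty
    have fx1 : IsC 1 (dx f) := hf.dx.smooth.of_le one_le_infty
    have z0 : (0 : WithTop ℕ∞) ≤ ∞ := zero_le
    have i1 := integrable_mul_of_isCompact a0 (hf.dt.dt.smooth.of_le z0) hf.dt.dt.compact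
    have i2 := integrable_mul_of_isCompact a0 (hf.dx.dx.smooth.of_le z0) hf.dx.dx.compact
    have i3 := integrable_mul_of_isCompact (h1.of_le zero_le_one) (hf.dt.smooth.of_le z0)
      hf.dt.compact
    have i4 := integrable_mul_of_isCompact (h2.of_le zero_le_one) (hf.dx.smooth.of_le z0)
      hf.dx.compact
    have i5 := integrable_mul_of_isCompact h0 (hf.smooth.of_le z0) hf.compact
    have j1 := integrable_mul_of_isCompact cat (hf.smooth.of_le z0) hf.compact
    have j2 := integrable_mul_of_isCompact cax (hf.smooth.of_le z0) hf.compact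
    have j3 := integrable_mul_of_isCompact cb1 (hf.smooth.of_le z0) hf.compact
    have j4 := integrable_mul_of_isCompact cb2 (hf.smooth.of_le z0) hf.compact
    rw [integral_combination i1 i2 i3 i4 i5, integral_mul_dt a1 ft1 hf.dt.compact,
      integral_mul_dt (ha.dt h11) f1 hf.compact,
      integral_mul_dx a1 fx1 hf.dx.compact, integral_mul_dx (ha.dx h11) f1 hf.compact,
      integral_mul_dt h1 f1 hf.compact, integral_mul_dx h2 f1 hf.compact] at e
    have e' : ∀ z : ℝ × ℝ, φ z • R z = dt (dt a) z.1 z.2 * f z.1 z.2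
        - c ^ 2 * (dx (dx a) z.1 z.2 * f z.1 z.2) + -(dt b₁ z.1 z.2 * f z.1 z.2)
        + -(dx b₂ z.1 z.2 * f z.1 z.2) + b₀ z.1 z.2 * f z.1 z.2 := by
      intro z
      simp only [R, f, smul_eq_mul]
      ring
    simp only [e']
    have s := integral_combination j1 j2 j3.neg j4.neg i5 (c ^ 2)
    simp only [Pi.neg_apply, integral_neg] at s
    linarith
  exact congrFun ((hR.ae_eq_iff_eq volume continuous_const).1 key) (t, x)

/-- Differentiation under the integral sign, for integrands supported in a fixed compact set. -/
lemma integral_deriv_eq_zero_of_integral_eq_zero {P P' : ℝ → ℝ × ℝ → ℝ} {K : Set (ℝ × ℝ)}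
    (hK : IsCompact K) (hP : ∀ ε z, HasDerivAt (fun ε => P ε z) (P' ε z) ε)
    (cP : ∀ ε, Continuous (P ε)) (cP' : Continuous fun q : ℝ × ℝ × ℝ => P' q.1 q.2)
    (sP : ∀ ε, ∀ z ∉ K, P ε z = 0) (h : ∀ ε, ∫ z, P ε z = 0) : ∫ z, P' 0 z = 0 := by
  have sP' : ∀ ε, ∀ z ∉ K, P' ε z = 0 := by
    intro ε z hz
    have := (hP ε z).deriv
    simp only [sP _ z hz, deriv_const] at this
    exact this.symm
  obtain ⟨C, hC⟩ := ((isCompact_closedBall (0 : ℝ) 1).prod hK).exists_bound_of_continuousOn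
    cP'.continuousOn
  have hd := (hasDerivAt_integral_of_dominated_loc_of_deriv_le (μ := volume) (F := P) (F' := P')
    (x₀ := 0) (s := Metric.ball 0 1) (bound := K.indicator fun _ => C)
    (Metric.ball_mem_nhds _ one_pos) (Eventually.of_forall fun ε => (cP ε).aestronglyMeasurable)
    ((cP 0).integrable_of_hasCompactSupport (HasCompactSupport.intro hK (sP 0)))
    (cP'.comp (by fun_prop : Continuous fun z : ℝ × ℝ => ((0 : ℝ), z))).aestronglyMeasurable
    (Eventually.of_forall fun z ε hε => ?_)
    ((integrable_indicator_iff hK.measurableSet).2 (integrableOn_const hK.measure_lt_top.ne))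
    (Eventually.of_forall fun z ε _ => hP ε z)).2
  · simp only [h] at hd
    exact (hd.unique (hasDerivAt_const 0 0))
  · by_cases hz : z ∈ K
    · rw [Set.indicator_of_mem hz]
      exact hC (ε, z) ⟨Metric.ball_subset_closedBall hε, hz⟩
    · rw [Set.indicator_of_notMem hz, sP' ε z hz, norm_zero]

/-- The term `g(t,x,u,p)` as a function on `ℝ⁴`. -/
def uncurry4 (g : ℝ → ℝ → ℝ → ℝ → ℝ) : ℝ × ℝ × ℝ × ℝ → ℝ := fun z => g z.1 z.2.1 z.2.2.1 z.2.2.2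

lemma dt_add_smul {φ : Field} (hu : IsC n u) (hφ : IsC n φ) (hn : 1 ≤ n) (ε : ℝ) :
    dt (fun t x => u t x + ε * φ t x) = fun t x => dt u t x + ε * dt φ t x := by
  funext t x
  exact ((hu.hasDerivAt_dt hn t x).add ((hφ.hasDerivAt_dt hn t x).const_mul ε)).deriv

lemma dx_add_smul {φ : Field} (hu : IsC n u) (hφ : IsC n φ) (hn : 1 ≤ n) (ε : ℝ) :
    dx (fun t x => u t x + ε * φ t x) = fun t x => dx u t x + ε * dx φ t x := by
  funext t x
  exact ((hu.hasDerivAt_dx hn t x).add ((hφ.hasDerivAt_dx hn t x).const_mul ε)).deriv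

lemma isC_linMultiplier (a b c₁ c₂ c₀ : ℝ) (hu : IsC ∞ u) :
    IsC ∞ (linMultiplier a b c₁ c₂ c₀ u) := by
  have h1 : IsC ∞ (dt u) := hu.dt le_rfl
  have h2 : IsC ∞ (dx u) := hu.dx le_rfl
  unfold IsC at *
  unfold linMultiplier
  fun_prop

lemma isC_waveExpr {g : ℝ → ℝ → ℝ → ℝ → ℝ} (hg : NonSingular m g) (hm : m ≤ ∞) (c : ℝ)
    (hu : IsC ∞ u) : IsC m (waveExpr c g u) := by
  have h0 := hu.of_le hm
  have h1 : IsC m (dt u) := (hu.dt (m := ∞) le_rfl).of_le hm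
  have h2 : IsC m (dt (dt u)) := ((hu.dt (m := ∞) le_rfl).dt (m := ∞) le_rfl).of_le hm
  have h3 : IsC m (dx (dx u)) := ((hu.dx (m := ∞) le_rfl).dx (m := ∞) le_rfl).of_le hm
  exact (ContDiff.sub h2 (contDiff_const.mul h3)).add
    (ContDiff.comp hg (contDiff_fst.prodMk (contDiff_snd.prodMk (ContDiff.prodMk h0 h1))))

/-- The first variation of `∬ (u_tt - c² u_xx + g) Q dt dx` vanishes when the integrand is a
divergence. -/
lemma integral_first_variation {g : ℝ → ℝ → ℝ → ℝ → ℝ} {c a b c₁ c₂ c₀ : ℝ} {T Ψ : FieldExpr}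
    (hm : 1 ≤ m) (hm' : m ≤ ∞) (hg : NonSingular m g)
    (h : IsConservationLaw m c g (linMultiplier a b c₁ c₂ c₀) T Ψ) (hu : IsC ∞ u) {φ : Field}
    (hφ : IsTest φ) :
    ∫ z : ℝ × ℝ, ((dt (dt φ) z.1 z.2 - c ^ 2 * dx (dx φ) z.1 z.2
      + fderiv ℝ (uncurry4 g) (z.1, z.2, u z.1 z.2, dt u z.1 z.2) (0, 0, φ z.1 z.2, dt φ z.1 z.2))
        * linMultiplier a b c₁ c₂ c₀ u z.1 z.2
      + waveExpr c g u z.1 z.2 * linMultiplier a b c₁ c₂ c₀ φ z.1 z.2) = 0 := by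
  obtain ⟨hT, hΨ, hdiv⟩ := h
  have hG : ContDiff ℝ m (uncurry4 g) := hg
  set Q := linMultiplier a b c₁ c₂ c₀
  have hut : IsC ∞ (dt u) := hu.dt le_rfl
  have hux : IsC ∞ (dx u) := hu.dx le_rfl
  have hv : ∀ ε : ℝ, IsC ∞ (fun t x => u t x + ε * φ t x) := fun ε =>
    ContDiff.add hu (contDiff_const.mul hφ.smooth)
  have hdt : ∀ ε : ℝ, dt (fun t x => u t x + ε * φ t x) = fun t x => dt u t x + ε * dt φ t x :=
    dt_add_smul hu hφ.smooth one_le_infty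
  have hdx : ∀ ε : ℝ, dx (fun t x => u t x + ε * φ t x) = fun t x => dx u t x + ε * dx φ t x :=
    dx_add_smul hu hφ.smooth one_le_infty
  have hW : ∀ ε t x, waveExpr c g (fun t x => u t x + ε * φ t x) t x =
      dt (dt u) t x + ε * dt (dt φ) t x - c ^ 2 * (dx (dx u) t x + ε * dx (dx φ) t x)
        + uncurry4 g (t, x, u t x + ε * φ t x, dt u t x + ε * dt φ t x) := by
    intro ε t x
    simp only [waveExpr, hdt, hdx, dt_add_smul hut hφ.dt.smooth one_le_infty,
      dx_add_smul hux hφ.dx.smooth one_le_infty, uncurry4]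
  have hQ : ∀ ε t x, Q (fun t x => u t x + ε * φ t x) t x = Q u t x + ε * Q φ t x := by
    intro ε t x
    simp only [Q, linMultiplier, hdt, hdx]
    ring
  -- the difference of the integrands for `u + ε φ` and `u`, which unlike them has compact support
  let P : ℝ → ℝ × ℝ → ℝ := fun ε z =>
    waveExpr c g (fun t x => u t x + ε * φ t x) z.1 z.2 * Q (fun t x => u t x + ε * φ t x) z.1 z.2
      - waveExpr c g u z.1 z.2 * Q u z.1 z.2
  let P' : ℝ → ℝ × ℝ → ℝ := fun ε z =>
    (dt (dt φ) z.1 z.2 - c ^ 2 * dx (dx φ) z.1 z.2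
      + fderiv ℝ (uncurry4 g) (z.1, z.2, u z.1 z.2 + ε * φ z.1 z.2, dt u z.1 z.2 + ε * dt φ z.1 z.2)
        (0, 0, φ z.1 z.2, dt φ z.1 z.2)) * (Q u z.1 z.2 + ε * Q φ z.1 z.2)
      + (dt (dt u) z.1 z.2 + ε * dt (dt φ) z.1 z.2
        - c ^ 2 * (dx (dx u) z.1 z.2 + ε * dx (dx φ) z.1 z.2)
        + uncurry4 g (z.1, z.2, u z.1 z.2 + ε * φ z.1 z.2, dt u z.1 z.2 + ε * dt φ z.1 z.2))
        * Q φ z.1 z.2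
  have hPP : ∀ ε z, HasDerivAt (fun ε => P ε z) (P' ε z) ε := by
    intro ε z
    simp only [P, hW, hQ]
    have e1 : ∀ p q : ℝ, HasDerivAt (fun ε : ℝ => p + ε * q) q ε := fun p q => by
      simpa using ((hasDerivAt_id ε).mul_const q).const_add p
    have e2 := HasFDerivAt.comp_hasDerivAt (f := fun ε : ℝ =>
      (z.1, z.2, u z.1 z.2 + ε * φ z.1 z.2, dt u z.1 z.2 + ε * dt φ z.1 z.2)) ε
      ((hG.differentiable (by positivity)) _).hasFDerivAt
      ((hasDerivAt_const ε z.1).prodMk ((hasDerivAt_const ε z.2).prodMk ((e1 _ _).prodMk (e1 _ _))))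
    exact ((((e1 _ _).sub ((e1 _ _).const_mul (c ^ 2))).add e2).mul (e1 _ _)).sub_const _
  have c1 := hu.continuous
  have c2 := hut.continuous
  have c3 := (hut.dt (m := ∞) le_rfl).continuous
  have c4 := (hux.dx (m := ∞) le_rfl).continuous
  have d1 := hφ.smooth.continuous
  have d2 := hφ.dt.smooth.continuous
  have d3 := hφ.dt.dt.smooth.continuous
  have d4 := hφ.dx.dx.smooth.continuous
  have q1 := (isC_linMultiplier a b c₁ c₂ c₀ hu).continuous
  have q2 := (isC_linMultiplier a b c₁ c₂ c₀ hφ.smooth).continuous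
  have cG := hG.continuous
  have cG' := hG.continuous_fderiv (by positivity)
  have hP'c : Continuous fun q : ℝ × ℝ × ℝ => P' q.1 q.2 := by
    have lift : ∀ {f : Field}, Continuous (fun z : ℝ × ℝ => f z.1 z.2) →
        Continuous fun q : ℝ × ℝ × ℝ => f q.2.1 q.2.2 := fun hf => hf.comp continuous_snd
    replace c1 := lift c1
    replace c2 := lift c2
    replace c3 := lift c3
    replace c4 := lift c4
    replace d1 := lift d1
    replace d2 := lift d2
    replace d3 := lift d3
    replace d4 := lift d4
    replace q1 := lift q1
    replace q2 := lift q2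
    have arg : Continuous fun q : ℝ × ℝ × ℝ => (q.2.1, q.2.2, u q.2.1 q.2.2 + q.1 * φ q.2.1 q.2.2,
      dt u q.2.1 q.2.2 + q.1 * dt φ q.2.1 q.2.2) :=
      continuous_snd.fst.prodMk (continuous_snd.snd.prodMk
        ((c1.add (continuous_fst.mul d1)).prodMk (c2.add (continuous_fst.mul d2))))
    have dir : Continuous fun q : ℝ × ℝ × ℝ =>
        ((0 : ℝ), (0 : ℝ), φ q.2.1 q.2.2, dt φ q.2.1 q.2.2) :=
      continuous_const.prodMk (continuous_const.prodMk (d1.prodMk d2))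
    exact (((d3.sub (continuous_const.mul d4)).add ((cG'.comp arg).clm_apply dir)).mul
      (q1.add (continuous_fst.mul q2))).add ((((c3.add (continuous_fst.mul d3)).sub
      (continuous_const.mul (c4.add (continuous_fst.mul d4)))).add (cG.comp arg)).mul q2)
  have hPc : ∀ ε, Continuous (P ε) := by
    intro ε
    simp only [P]
    exact ((isC_waveExpr hg hm' c (hv ε)).continuous.mul
      (isC_linMultiplier a b c₁ c₂ c₀ (hv ε)).continuous).sub
      ((isC_waveExpr hg hm' c hu).continuous.mul q1)
  have off : ∀ z ∉ fieldSupport φ, φ z.1 z.2 = 0 ∧ dt φ z.1 z.2 = 0 ∧ dx φ z.1 z.2 = 0 ∧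
      dt (dt φ) z.1 z.2 = 0 ∧ dx (dx φ) z.1 z.2 = 0 := by
    intro z hz
    have s1 := fieldSupport_dt hφ.smooth one_le_infty
    have s2 := fieldSupport_dx hφ.smooth one_le_infty
    have s3 := fieldSupport_dt hφ.dt.smooth one_le_infty
    have s4 := fieldSupport_dx hφ.dx.smooth one_le_infty
    exact ⟨eq_zero_of_notMem_fieldSupport hz, eq_zero_of_notMem_fieldSupport fun h => hz (s1 h),
      eq_zero_of_notMem_fieldSupport fun h => hz (s2 h),
      eq_zero_of_notMem_fieldSupport fun h => hz (s1 (s3 h)),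
      eq_zero_of_notMem_fieldSupport fun h => hz (s2 (s4 h))⟩
  have hPs : ∀ ε, ∀ z ∉ fieldSupport φ, P ε z = 0 := by
    intro ε z hz
    obtain ⟨o1, o2, o3, o4, o5⟩ := off z hz
    simp only [P, hW, hQ]
    simp only [Q, linMultiplier, o1, o2, o3, o4, o5, mul_zero, add_zero]
    simp only [waveExpr, uncurry4, sub_self]
  have hPi : ∀ ε, ∫ z, P ε z = 0 := by
    intro ε
    have loc : ∀ {A : FieldExpr}, IsDiffFunction m A → IsC m (fun t x =>
        A (fun t x => u t x + ε * φ t x) t x + (-1) * A u t x) ∧ IsCompact (fieldSupport (fun t x =>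
        A (fun t x => u t x + ε * φ t x) t x + (-1) * A u t x)) := by
      intro A hA
      refine ⟨ContDiff.add (hA.isC hm' (hv ε)) (contDiff_const.mul (hA.isC hm' hu)), ?_⟩
      refine hφ.compact.of_isClosed_subset (isClosed_tsupport _)
        (closure_minimal (fun z hz => ?_) (isClosed_tsupport _))
      by_contra hn
      refine hz ?_
      obtain ⟨k, hk⟩ := hA.congr
      have : EqJets k (fun t x => u t x + ε * φ t x) u z.1 z.2 := by
        -- the two fields agree on a neighbourhood of `z`
        have hev : ∀ᶠ y in 𝓝 z, φ y.1 y.2 = 0 ∧ dt φ y.1 y.2 = 0 := by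
          filter_upwards [(isClosed_tsupport _).isOpen_compl.mem_nhds hn] with y hy
          exact ⟨(off y hy).1, (off y hy).2.1⟩
        have hev' : ∀ᶠ ξ in 𝓝 z.2, φ z.1 ξ = 0 ∧ dt φ z.1 ξ = 0 :=
          (Continuous.tendsto (f := fun ξ : ℝ => (z.1, ξ)) (by fun_prop) z.2).eventually hev
        refine ⟨fun i _ => Filter.EventuallyEq.iteratedDeriv_eq i ?_,
          fun i _ => Filter.EventuallyEq.iteratedDeriv_eq i ?_⟩
        · filter_upwards [hev'] with ξ hξ
          rw [hξ.1, mul_zero, add_zero]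
        · filter_upwards [hev'] with ξ hξ
          simp only [hdt, hξ.2, mul_zero, add_zero]
      simp only
      rw [hk (hv ε) hu this]
      ring
    have e : ∀ z : ℝ × ℝ, P ε z = dt (fun t x => T (fun t x => u t x + ε * φ t x) t x
        + (-1) * T u t x) z.1 z.2 + dx (fun t x => Ψ (fun t x => u t x + ε * φ t x) t x
        + (-1) * Ψ u t x) z.1 z.2 := by
      intro z
      rw [dt_add_smul (hT.isC hm' (hv ε)) (hT.isC hm' hu) hm,
        dx_add_smul (hΨ.isC hm' (hv ε)) (hΨ.isC hm' hu) hm]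
      simp only [P]
      rw [hdiv _ (hv ε), hdiv _ hu]
      ring
    have tC := loc hT
    have pC := loc hΨ
    simp only [e]
    rw [integral_add, integral_dt_eq_zero (tC.1.of_le hm) tC.2,
      integral_dx_eq_zero (pC.1.of_le hm) pC.2, add_zero]
    · exact ((tC.1.of_le hm).dt (m := 0) le_rfl).continuous.integrable_of_hasCompactSupport
        (tC.2.of_isClosed_subset (isClosed_tsupport _) (fieldSupport_dt tC.1 hm))
    · exact ((pC.1.of_le hm).dx (m := 0) le_rfl).continuous.integrable_of_hasCompactSupport
        (pC.2.of_isClosed_subset (isClosed_tsupport _) (fieldSupport_dx pC.1 hm))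
  have := integral_deriv_eq_zero_of_integral_eq_zero hφ.compact hPP hPc hP'c hPs hPi
  simp only [P', zero_mul, add_zero] at this
  exact this

end

/-! ### The Euler–Lagrange equation at a point -/

section

open MeasureTheory Topology Filter

variable {m n : WithTop ℕ∞} {u v : Field}

lemma contDiff_fderiv_uncurry4 {g : ℝ → ℝ → ℝ → ℝ → ℝ} (hg : NonSingular 2 g) (e : ℝ × ℝ × ℝ × ℝ) :
    ContDiff ℝ 1 fun z => fderiv ℝ (uncurry4 g) z e :=
  (ContDiff.fderiv_right (f := uncurry4 g) (m := 1) hg (by rw [one_add_one_eq_two])).clm_apply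
    contDiff_const

/-- Chain rule for a `C^1` function of `t, x, u, u_t`, in the variable `t`. -/
lemma dt_comp {G : ℝ × ℝ × ℝ × ℝ → ℝ} (hG : ContDiff ℝ 1 G) (hu : IsC ∞ u) (t x : ℝ) :
    HasDerivAt (fun τ => G (τ, x, u τ x, dt u τ x))
      (fderiv ℝ G (t, x, u t x, dt u t x) (1, 0, dt u t x, dt (dt u) t x)) t :=
  HasFDerivAt.comp_hasDerivAt (f := fun τ => (τ, x, u τ x, dt u τ x)) t
    ((hG.differentiable (by simp)) _).hasFDerivAt ((hasDerivAt_id t).prodMk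
    ((hasDerivAt_const t x).prodMk ((hu.hasDerivAt_dt one_le_infty t x).prodMk
    ((hu.dt (m := ∞) le_rfl).hasDerivAt_dt one_le_infty t x))))

/-- Chain rule for a `C^1` function of `t, x, u, u_t`, in the variable `x`. -/
lemma dx_comp {G : ℝ × ℝ × ℝ × ℝ → ℝ} (hG : ContDiff ℝ 1 G) (hu : IsC ∞ u) (t x : ℝ) :
    HasDerivAt (fun ξ => G (t, ξ, u t ξ, dt u t ξ))
      (fderiv ℝ G (t, x, u t x, dt u t x) (0, 1, dx u t x, dx (dt u) t x)) x :=
  HasFDerivAt.comp_hasDerivAt (f := fun ξ => (t, ξ, u t ξ, dt u t ξ)) x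
    ((hG.differentiable (by simp)) _).hasFDerivAt ((hasDerivAt_const x t).prodMk
    ((hasDerivAt_id x).prodMk ((hu.hasDerivAt_dx one_le_infty t x).prodMk
    ((hu.dt (m := ∞) le_rfl).hasDerivAt_dx one_le_infty t x))))

/-- The Euler–Lagrange equation of `(u_tt - c² u_xx + g) Q`, for an arbitrary smooth field. -/
lemma euler_eq {g : ℝ → ℝ → ℝ → ℝ → ℝ} {c a b c₁ c₂ c₀ : ℝ} {T Ψ : FieldExpr}
    (hm : 2 ≤ m) (hm' : m ≤ ∞) (hg : NonSingular m g)
    (h : IsConservationLaw m c g (linMultiplier a b c₁ c₂ c₀) T Ψ) (hu : IsC ∞ u) (t x : ℝ) :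
    let E : Field := fun t x => Real.exp (a * t + b * x)
    let Q := linMultiplier a b c₁ c₂ c₀ u
    let W := waveExpr c g u
    let gu : Field := fun t x => fderiv ℝ (uncurry4 g) (t, x, u t x, dt u t x) (0, 0, 1, 0)
    let gp : Field := fun t x => fderiv ℝ (uncurry4 g) (t, x, u t x, dt u t x) (0, 0, 0, 1)
    dt (dt Q) t x - c ^ 2 * dx (dx Q) t x
      - dt (fun t x => gp t x * Q t x + c₁ * (E t x * W t x)) t x
      - dx (fun t x => c₂ * (E t x * W t x)) t x + (gu t x * Q t x + c₀ * (E t x * W t x)) = 0 := by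
  intro E Q W gu gp
  have hg2 : NonSingular 2 g := ContDiff.of_le hg hm
  have hE : ContDiff ℝ ∞ fun z : ℝ × ℝ => E z.1 z.2 := by simp only [E]; fun_prop
  have hQ : IsC ∞ Q := isC_linMultiplier a b c₁ c₂ c₀ hu
  have hW : IsC 2 W := (isC_waveExpr hg hm' c hu).of_le hm
  have hG : ∀ e, IsC 1 fun t x => fderiv ℝ (uncurry4 g) (t, x, u t x, dt u t x) e := fun e =>
    (contDiff_fderiv_uncurry4 hg2 e).comp (contDiff_fst.prodMk (contDiff_snd.prodMk
      (ContDiff.prodMk (hu.of_le one_le_infty) ((hu.dt (m := ∞) le_rfl).of_le one_le_infty))))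
  have hEW : IsC 1 fun t x => E t x * W t x :=
    ContDiff.mul (hE.of_le one_le_infty) (hW.of_le one_le_two)
  have hEW0 := hEW.of_le zero_le_one
  refine euler_eq_of_integral_eq_zero (a := Q)
    (b₁ := fun t x => gp t x * Q t x + c₁ * (E t x * W t x))
    (b₂ := fun t x => c₂ * (E t x * W t x)) (b₀ := fun t x => gu t x * Q t x + c₀ * (E t x * W t x))
    (hQ.of_le two_le_infty) ?_ ?_ ?_ (fun φ hφ => ?_) t x
  · exact ContDiff.add (ContDiff.mul ((hG _).of_le zero_le_one) (hQ.of_le zero_le))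
      (contDiff_const.mul hEW0)
  · exact ContDiff.add (ContDiff.mul (hG _) (hQ.of_le one_le_infty)) (contDiff_const.mul hEW)
  · exact contDiff_const.mul hEW
  · rw [← integral_first_variation (one_le_two.trans hm) hm' hg h hu hφ]
    congr 1
    funext z
    have split : ∀ r s : ℝ, ((0, 0, r, s) : ℝ × ℝ × ℝ × ℝ) =
        r • (0, 0, 1, 0) + s • (0, 0, 0, 1) := by
      intro r s; simp
    rw [split, map_add, map_smul, map_smul]
    simp only [smul_eq_mul, Q, E, W, gu, gp, linMultiplier]
    ring

/-- A quadratic polynomial with prescribed value, first and second derivatives at `(t₀, x₀)`. -/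
noncomputable def quadField (t₀ x₀ y p r A B C : ℝ) : Field := fun t x =>
  y + p * (t - t₀) + r * (x - x₀) + A / 2 * (t - t₀) ^ 2 + B * (t - t₀) * (x - x₀)
    + C / 2 * (x - x₀) ^ 2

/-- An affine function of `t, x`. -/
noncomputable def affField (t₀ x₀ y p r : ℝ) : Field := fun t x => y + p * (t - t₀) + r * (x - x₀)

lemma dt_quadField (t₀ x₀ y p r A B C : ℝ) :
    dt (quadField t₀ x₀ y p r A B C) = affField t₀ x₀ p A B := by
  funext t x
  have h : HasDerivAt (fun τ : ℝ => τ - t₀) 1 t := (hasDerivAt_id t).sub_const t₀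
  have := ((((h.const_mul p).const_add y).add_const (r * (x - x₀))).add
    ((h.pow 2).const_mul (A / 2))).add ((h.const_mul B).mul_const (x - x₀)) |>.add_const
    (C / 2 * (x - x₀) ^ 2)
  refine this.deriv.trans ?_
  simp only [affField]
  push_cast
  ring

lemma dx_quadField (t₀ x₀ y p r A B C : ℝ) :
    dx (quadField t₀ x₀ y p r A B C) = affField t₀ x₀ r B C := by
  funext t x
  have h : HasDerivAt (fun ξ : ℝ => ξ - x₀) 1 x := (hasDerivAt_id x).sub_const x₀
  have := (((h.const_mul r).const_add (y + p * (t - t₀))).add_const (A / 2 * (t - t₀) ^ 2)).add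
    (h.const_mul (B * (t - t₀))) |>.add ((h.pow 2).const_mul (C / 2))
  refine this.deriv.trans ?_
  simp only [affField]
  push_cast
  ring

lemma dt_affField (t₀ x₀ y p r : ℝ) : dt (affField t₀ x₀ y p r) = fun _ _ => p := by
  funext t x
  have h : HasDerivAt (fun τ : ℝ => τ - t₀) 1 t := (hasDerivAt_id t).sub_const t₀
  have := ((h.const_mul p).const_add y).add_const (r * (x - x₀))
  exact this.deriv.trans (mul_one p)

lemma dx_affField (t₀ x₀ y p r : ℝ) : dx (affField t₀ x₀ y p r) = fun _ _ => r := by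
  funext t x
  have h : HasDerivAt (fun ξ : ℝ => ξ - x₀) 1 x := (hasDerivAt_id x).sub_const x₀
  have := (h.const_mul r).const_add (y + p * (t - t₀))
  exact this.deriv.trans (mul_one r)

lemma hasDerivAt_exp_mul_fst {a b : ℝ} {f : ℝ → ℝ} {f' t : ℝ} (hf : HasDerivAt f f' t) (x : ℝ) :
    HasDerivAt (fun τ => Real.exp (a * τ + b * x) * f τ)
      (Real.exp (a * t + b * x) * (a * f t + f')) t := by
  have h : HasDerivAt (fun τ : ℝ => a * τ + b * x) a t := by
    simpa using ((hasDerivAt_id t).const_mul a).add_const (b * x)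
  exact (h.exp.mul hf).congr_deriv (by ring)

lemma hasDerivAt_exp_mul_snd {a b : ℝ} {f : ℝ → ℝ} {f' x : ℝ} (hf : HasDerivAt f f' x) (t : ℝ) :
    HasDerivAt (fun ξ => Real.exp (a * t + b * ξ) * f ξ)
      (Real.exp (a * t + b * x) * (b * f x + f')) x := by
  have h : HasDerivAt (fun ξ : ℝ => a * t + b * ξ) b x := by
    simpa using ((hasDerivAt_id x).const_mul b).const_add (a * t)
  exact (h.exp.mul hf).congr_deriv (by ring)

/-- The Euler–Lagrange equation at a point, in terms of the values `y, p, r, A, B, C` of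
`u, u_t, u_x, u_tt, u_tx, u_xx` there. -/
lemma determining_eq {g : ℝ → ℝ → ℝ → ℝ → ℝ} {c a b c₁ c₂ c₀ : ℝ} {T Ψ : FieldExpr}
    (hm : 2 ≤ m) (hm' : m ≤ ∞) (hg : NonSingular m g)
    (h : IsConservationLaw m c g (linMultiplier a b c₁ c₂ c₀) T Ψ) (t x y p r A B C : ℝ) :
    let G := uncurry4 g
    let gp : ℝ × ℝ × ℝ × ℝ → ℝ := fun z => fderiv ℝ G z (0, 0, 0, 1)
    let z : ℝ × ℝ × ℝ × ℝ := (t, x, y, p)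
    let q := c₁ * p + c₂ * r + c₀ * y
    let qt := c₁ * A + c₂ * B + c₀ * p
    let qx := c₁ * B + c₂ * C + c₀ * r
    let W := A - c ^ 2 * C + g t x y p
    a ^ 2 * q + 2 * a * qt + c₀ * A - c ^ 2 * (b ^ 2 * q + 2 * b * qx + c₀ * C)
      - (a * (gp z * q + c₁ * W) + fderiv ℝ gp z (1, 0, p, A) * q + gp z * qt
        + c₁ * fderiv ℝ G z (1, 0, p, A))
      - c₂ * (b * W + fderiv ℝ G z (0, 1, r, B)) + fderiv ℝ G z (0, 0, 1, 0) * q + c₀ * W = 0 := by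
  intro G gp z q qt qx W
  set u : Field := quadField t x y p r A B C with hu
  have hG1 : ContDiff ℝ 1 G := ContDiff.of_le hg (one_le_two.trans hm)
  have hgp : ContDiff ℝ 1 gp := contDiff_fderiv_uncurry4 (ContDiff.of_le hg hm) _
  have hU : IsC ∞ u := by unfold IsC; simp only [hu, quadField]; fun_prop
  have E := euler_eq hm hm' hg h hU t x
  have dtu : dt u = affField t x p A B := dt_quadField t x y p r A B C
  have dxu : dx u = affField t x r B C := dx_quadField t x y p r A B C
  have u0 : u t x = y := by simp [hu, quadField]
  have ut0 : dt u t x = p := by simp [dtu, affField]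
  have ux0 : dx u t x = r := by simp [dxu, affField]
  have utt : dt (dt u) = fun _ _ => A := by rw [dtu, dt_affField]
  have utx : dx (dt u) = fun _ _ => B := by rw [dtu, dx_affField]
  have uxt : dt (dx u) = fun _ _ => B := by rw [dxu, dt_affField]
  have uxx : dx (dx u) = fun _ _ => C := by rw [dxu, dx_affField]
  have hut : IsC ∞ (dt u) := hU.dt le_rfl
  have hux : IsC ∞ (dx u) := hU.dx le_rfl
  -- the multiplier is `e^{at+bx} Q₀`, with `Q₀` affine
  set Q₀ : Field := fun t x => c₁ * dt u t x + c₂ * dx u t x + c₀ * u t x with hQ₀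
  have Q0 : Q₀ t x = q := by simp only [hQ₀, u0, ut0, ux0, q]
  have dQt : ∀ τ ξ, HasDerivAt (fun τ => Q₀ τ ξ) (c₁ * A + c₂ * B + c₀ * dt u τ ξ) τ := by
    intro τ ξ
    have := (((hut.hasDerivAt_dt one_le_infty τ ξ).const_mul c₁).add
      ((hux.hasDerivAt_dt one_le_infty τ ξ).const_mul c₂)).add
      ((hU.hasDerivAt_dt one_le_infty τ ξ).const_mul c₀)
    simp only [utt, uxt] at this
    exact this
  have dQx : ∀ τ ξ, HasDerivAt (fun ξ => Q₀ τ ξ) (c₁ * B + c₂ * C + c₀ * dx u τ ξ) ξ := by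
    intro τ ξ
    have := (((hut.hasDerivAt_dx one_le_infty τ ξ).const_mul c₁).add
      ((hux.hasDerivAt_dx one_le_infty τ ξ).const_mul c₂)).add
      ((hU.hasDerivAt_dx one_le_infty τ ξ).const_mul c₀)
    simp only [utx, uxx] at this
    exact this
  have e1 : dt (linMultiplier a b c₁ c₂ c₀ u) = fun t x => Real.exp (a * t + b * x) *
      (a * Q₀ t x + (c₁ * A + c₂ * B + c₀ * dt u t x)) := by
    funext τ ξ
    exact (hasDerivAt_exp_mul_fst (dQt τ ξ) ξ).deriv
  have e2 : dt (dt (linMultiplier a b c₁ c₂ c₀ u)) t x = Real.exp (a * t + b * x) *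
      (a * (a * q + qt) + (a * qt + c₀ * A)) := by
    rw [e1]
    refine (hasDerivAt_exp_mul_fst (((dQt t x).const_mul a).add
      (((hut.hasDerivAt_dt one_le_infty t x).const_mul c₀).const_add _)) x).deriv.trans ?_
    simp only [Pi.add_apply, Q0, ut0, utt, qt]
  have e3 : dx (linMultiplier a b c₁ c₂ c₀ u) = fun t x => Real.exp (a * t + b * x) *
      (b * Q₀ t x + (c₁ * B + c₂ * C + c₀ * dx u t x)) := by
    funext τ ξ
    exact (hasDerivAt_exp_mul_snd (dQx τ ξ) τ).deriv
  have e4 : dx (dx (linMultiplier a b c₁ c₂ c₀ u)) t x = Real.exp (a * t + b * x) *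
      (b * (b * q + qx) + (b * qx + c₀ * C)) := by
    rw [e3]
    refine (hasDerivAt_exp_mul_snd (((dQx t x).const_mul b).add
      (((hux.hasDerivAt_dx one_le_infty t x).const_mul c₀).const_add _)) t).deriv.trans ?_
    simp only [Pi.add_apply, Q0, ux0, uxx, qx]
  have hW : ∀ τ ξ, waveExpr c g u τ ξ = A - c ^ 2 * C + G (τ, ξ, u τ ξ, dt u τ ξ) := by
    intro τ ξ
    simp only [waveExpr, utt, uxx, G, uncurry4]
  have W0 : waveExpr c g u t x = W := by
    rw [hW, u0, ut0]
    rfl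
  have dWt := (dt_comp hG1 hU t x).const_add (A - c ^ 2 * C)
  have dWx := (dx_comp hG1 hU t x).const_add (A - c ^ 2 * C)
  have dgp := dt_comp hgp hU t x
  simp only [u0, ut0, ux0, utt, utx, ← hW] at dWt dWx dgp
  have e5 : dt (fun t x => fderiv ℝ G (t, x, u t x, dt u t x) (0, 0, 0, 1)
      * linMultiplier a b c₁ c₂ c₀ u t x + c₁ * (Real.exp (a * t + b * x) * waveExpr c g u t x)) t x
      = Real.exp (a * t + b * x) * (a * (gp z * q + c₁ * W) + (fderiv ℝ gp z (1, 0, p, A) * q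
        + gp z * qt + c₁ * fderiv ℝ G z (1, 0, p, A))) := by
    have := hasDerivAt_exp_mul_fst (a := a) (b := b) ((dgp.mul (dQt t x)).add (dWt.const_mul c₁)) x
    have e : (fun τ => fderiv ℝ G (τ, x, u τ x, dt u τ x) (0, 0, 0, 1)
        * linMultiplier a b c₁ c₂ c₀ u τ x + c₁ * (Real.exp (a * τ + b * x) * waveExpr c g u τ x))
        = fun τ => Real.exp (a * τ + b * x) * (gp (τ, x, u τ x, dt u τ x) * Q₀ τ x
          + c₁ * waveExpr c g u τ x) := by
      funext τ
      simp only [linMultiplier, Q₀, gp]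
      ring
    refine (congrArg (fun f => deriv f t) e).trans (this.deriv.trans ?_)
    simp only [Pi.add_apply, Pi.mul_apply, u0, ut0, Q0, W0, z, qt]
  have e6 : dx (fun t x => c₂ * (Real.exp (a * t + b * x) * waveExpr c g u t x)) t x
      = Real.exp (a * t + b * x) * (c₂ * (b * W + fderiv ℝ G z (0, 1, r, B))) := by
    refine ((hasDerivAt_exp_mul_snd (a := a) (b := b) dWx t).const_mul c₂).deriv.trans ?_
    simp only [W0, z]
    ring
  simp only at E
  rw [e2, e4, e5, e6, W0, u0, ut0] at E
  have eQ : linMultiplier a b c₁ c₂ c₀ u t x = Real.exp (a * t + b * x) * q := by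
    simp only [linMultiplier, u0, ut0, ux0, q]
  rw [eQ] at E
  refine mul_left_cancel₀ (Real.exp_pos (a * t + b * x)).ne' ?_
  rw [mul_zero]
  refine Eq.trans ?_ E
  simp only [G, z]
  ring

end

/-! ### Solution of the determining equations -/

section

open MeasureTheory Topology Filter

variable {m n : WithTop ℕ∞} {u v : Field}

/-- The partial derivative `g_p` of `g(t,x,u,p)`. -/
noncomputable def partialP (g : ℝ → ℝ → ℝ → ℝ → ℝ) : ℝ × ℝ × ℝ × ℝ → ℝ :=
  fun z => fderiv ℝ (uncurry4 g) z (0, 0, 0, 1)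

lemma map_quadruple (L : ℝ × ℝ × ℝ × ℝ →L[ℝ] ℝ) (α β γ δ : ℝ) :
    L (α, β, γ, δ) = α * L (1, 0, 0, 0) + β * L (0, 1, 0, 0) + γ * L (0, 0, 1, 0)
      + δ * L (0, 0, 0, 1) := by
  have : ((α, β, γ, δ) : ℝ × ℝ × ℝ × ℝ) = α • (1, 0, 0, 0) + β • (0, 1, 0, 0) + γ • (0, 0, 1, 0)
      + δ • (0, 0, 0, 1) := by simp
  rw [this]
  simp only [map_add, map_smul, smul_eq_mul]

/-- The Euler–Lagrange equation split with respect to `u_tx`, `u_xx`, `u_tt`, and the remaining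
part at `u_t = u_x = 0`, the latter at points with `g_tp = 0`. -/
lemma determining_system {g : ℝ → ℝ → ℝ → ℝ → ℝ} {c a b c₁ c₂ c₀ : ℝ} {T Ψ : FieldExpr}
    (hm : 2 ≤ m) (hm' : m ≤ ∞) (hc : 0 < c) (hg : NonSingular m g)
    (h : IsConservationLaw m c g (linMultiplier a b c₁ c₂ c₀) T Ψ) :
    (∀ z, c₂ * partialP g z = a * c₂ - c ^ 2 * b * c₁) ∧
    2 * c₀ = a * c₁ - b * c₂ ∧
    (∀ t x y p r, fderiv ℝ (partialP g) (t, x, y, p) (0, 0, 0, 1) * (c₁ * p + c₂ * r + c₀ * y) =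
      2 * (a * c₁ - b * c₂ - c₁ * partialP g (t, x, y, p))) ∧
    (∀ t x y, fderiv ℝ (partialP g) (t, x, y, 0) (1, 0, 0, 0) = 0 →
      c₁ * fderiv ℝ (uncurry4 g) (t, x, y, 0) (1, 0, 0, 0)
        + c₂ * fderiv ℝ (uncurry4 g) (t, x, y, 0) (0, 1, 0, 0)
        - c₀ * y * fderiv ℝ (uncurry4 g) (t, x, y, 0) (0, 0, 1, 0) =
      (a ^ 2 - c ^ 2 * b ^ 2 - a * partialP g (t, x, y, 0)) * c₀ * y
        - (a * c₁ + b * c₂ - c₀) * g t x y 0) := by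
  have D := fun t x y p r A B C => determining_eq hm hm' hg h t x y p r A B C
  simp only at D
  change ∀ t x y p r A B C : ℝ, a ^ 2 * (c₁ * p + c₂ * r + c₀ * y)
    + 2 * a * (c₁ * A + c₂ * B + c₀ * p) + c₀ * A - c ^ 2 * (b ^ 2 * (c₁ * p + c₂ * r + c₀ * y)
    + 2 * b * (c₁ * B + c₂ * C + c₀ * r) + c₀ * C)
    - (a * (partialP g (t, x, y, p) * (c₁ * p + c₂ * r + c₀ * y)
        + c₁ * (A - c ^ 2 * C + g t x y p))
      + fderiv ℝ (partialP g) (t, x, y, p) (1, 0, p, A) * (c₁ * p + c₂ * r + c₀ * y)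
      + partialP g (t, x, y, p) * (c₁ * A + c₂ * B + c₀ * p)
      + c₁ * fderiv ℝ (uncurry4 g) (t, x, y, p) (1, 0, p, A))
    - c₂ * (b * (A - c ^ 2 * C + g t x y p) + fderiv ℝ (uncurry4 g) (t, x, y, p) (0, 1, r, B))
    + fderiv ℝ (uncurry4 g) (t, x, y, p) (0, 0, 1, 0) * (c₁ * p + c₂ * r + c₀ * y)
    + c₀ * (A - c ^ 2 * C + g t x y p) = 0 at D
  replace D : ∀ t x y p r A B C : ℝ, a ^ 2 * (c₁ * p + c₂ * r + c₀ * y)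
    + 2 * a * (c₁ * A + c₂ * B + c₀ * p) + c₀ * A - c ^ 2 * (b ^ 2 * (c₁ * p + c₂ * r + c₀ * y)
    + 2 * b * (c₁ * B + c₂ * C + c₀ * r) + c₀ * C)
    - (a * (partialP g (t, x, y, p) * (c₁ * p + c₂ * r + c₀ * y)
        + c₁ * (A - c ^ 2 * C + g t x y p))
      + (fderiv ℝ (partialP g) (t, x, y, p) (1, 0, 0, 0)
        + p * fderiv ℝ (partialP g) (t, x, y, p) (0, 0, 1, 0)
        + A * fderiv ℝ (partialP g) (t, x, y, p) (0, 0, 0, 1)) * (c₁ * p + c₂ * r + c₀ * y)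
      + partialP g (t, x, y, p) * (c₁ * A + c₂ * B + c₀ * p)
      + c₁ * (fderiv ℝ (uncurry4 g) (t, x, y, p) (1, 0, 0, 0)
        + p * fderiv ℝ (uncurry4 g) (t, x, y, p) (0, 0, 1, 0) + A * partialP g (t, x, y, p)))
    - c₂ * (b * (A - c ^ 2 * C + g t x y p) + fderiv ℝ (uncurry4 g) (t, x, y, p) (0, 1, 0, 0)
      + r * fderiv ℝ (uncurry4 g) (t, x, y, p) (0, 0, 1, 0) + B * partialP g (t, x, y, p))
    + fderiv ℝ (uncurry4 g) (t, x, y, p) (0, 0, 1, 0) * (c₁ * p + c₂ * r + c₀ * y)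
    + c₀ * (A - c ^ 2 * C + g t x y p) = 0 := by
    intro t x y p r A B C
    have e1 := map_quadruple (fderiv ℝ (partialP g) (t, x, y, p)) 1 0 p A
    have e2 : _ = _ + A * partialP g (t, x, y, p) :=
      map_quadruple (fderiv ℝ (uncurry4 g) (t, x, y, p)) 1 0 p A
    have e3 : _ = _ + B * partialP g (t, x, y, p) :=
      map_quadruple (fderiv ℝ (uncurry4 g) (t, x, y, p)) 0 1 r B
    linear_combination D t x y p r A B C + (c₁ * p + c₂ * r + c₀ * y) * e1 + c₁ * e2 + c₂ * e3
  have hC : 2 * c₀ = a * c₁ - b * c₂ := by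
    have d1 := D 0 0 0 0 0 0 0 1
    have d0 := D 0 0 0 0 0 0 0 0
    refine mul_left_cancel₀ (pow_pos hc 2).ne' ?_
    linear_combination d0 - d1
  -- the equation is affine in `A, B, C`: the difference of two evaluations is a coefficient
  refine ⟨fun z => ?_, hC, fun t x y p r => ?_, fun t x y h0 => ?_⟩
  · obtain ⟨t, x, y, p⟩ := z
    have d1 := D t x y p 0 0 1 0
    have d0 := D t x y p 0 0 0 0
    linear_combination (d0 - d1) / 2
  · have d1 := D t x y p r 1 0 0
    have d0 := D t x y p r 0 0 0
    linear_combination d0 - d1 + hC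
  · have d := D t x y 0 0 0 0 0
    simp only [h0] at d
    linear_combination -d

/-- `g_p` is constant. When `c₂ = 0` this comes from an ordinary differential equation in `p`, whose
only solution without a singularity is the constant one. -/
lemma exists_partialP_eq {g : ℝ → ℝ → ℝ → ℝ → ℝ} {c a b c₁ c₂ c₀ : ℝ} (hc : 0 < c)
    (hg : NonSingular 2 g) (hne : (c₁, c₂, c₀) ≠ (0, 0, 0))
    (h1 : ∀ z, c₂ * partialP g z = a * c₂ - c ^ 2 * b * c₁)
    (h2 : 2 * c₀ = a * c₁ - b * c₂)
    (h3 : ∀ t x y p r, fderiv ℝ (partialP g) (t, x, y, p) (0, 0, 0, 1)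
      * (c₁ * p + c₂ * r + c₀ * y) = 2 * (a * c₁ - b * c₂ - c₁ * partialP g (t, x, y, p))) :
    ∃ α, (∀ z, partialP g z = α) ∧ c₁ * α = a * c₁ - b * c₂ ∧ c₂ * α = a * c₂ - c ^ 2 * b * c₁ := by
  have hd : Differentiable ℝ (partialP g) :=
    (contDiff_fderiv_uncurry4 hg (0, 0, 0, 1)).differentiable (by simp)
  by_cases h : c₂ = 0
  · subst h
    have hc₁ : c₁ ≠ 0 := by
      rintro rfl
      refine hne ?_
      have : c₀ = 0 := by linarith
      rw [this]
    have hb : b = 0 := by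
      have := h1 0
      have h' : c ^ 2 * c₁ * b = 0 := by linear_combination this
      exact (mul_eq_zero.1 h').resolve_left (mul_ne_zero (pow_pos hc 2).ne' hc₁)
    subst hb
    refine ⟨a, ?_, by ring, by ring⟩
    rintro ⟨t, x, y, p⟩
    have e : ∀ p, fderiv ℝ (partialP g) (t, x, y, p) (0, 0, 0, 1) * (p + a / 2 * y) =
        2 * (a - partialP g (t, x, y, p)) := by
      intro p
      refine mul_left_cancel₀ hc₁ ?_
      have := h3 t x y p 0
      have h0 : c₀ = a / 2 * c₁ := by linarith
      rw [h0] at this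
      linear_combination this
    -- the singular solutions `g_p = a + const / (p + a y / 2)²` are excluded: the function below is
    -- constant in `p`, and it vanishes at `p = -a y / 2`
    have hder : ∀ p, HasDerivAt
        (fun p => (p + a / 2 * y) ^ 2 * (partialP g (t, x, y, p) - a)) 0 p := by
      intro p
      have d1 : HasDerivAt (fun p => partialP g (t, x, y, p))
          (fderiv ℝ (partialP g) (t, x, y, p) (0, 0, 0, 1)) p :=
        HasFDerivAt.comp_hasDerivAt (f := fun p => (t, x, y, p)) p (hd _).hasFDerivAt
          ((hasDerivAt_const p t).prodMk ((hasDerivAt_const p x).prodMk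
          ((hasDerivAt_const p y).prodMk (hasDerivAt_id p))))
      have d2 : HasDerivAt (fun p : ℝ => (p + a / 2 * y) ^ 2) (2 * (p + a / 2 * y)) p := by
        exact (((hasDerivAt_id p).add_const (a / 2 * y)).pow 2).congr_deriv (by simp)
      refine (d2.mul (d1.sub_const a)).congr_deriv ?_
      linear_combination (p + a / 2 * y) * e p
    have key := is_const_of_deriv_eq_zero (fun p => (hder p).differentiableAt)
      (fun p => (hder p).deriv) p (-(a / 2 * y))
    simp only [neg_add_cancel, ne_eq, OfNat.ofNat_ne_zero, not_false_eq_true, zero_pow, zero_mul]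
      at key
    rcases mul_eq_zero.1 key with h' | h'
    -- at `p = -a y / 2` itself the differential equation reads `g_p = a`
    · have h'' : p + a / 2 * y = 0 := by simpa using h'
      have := e p
      rw [h''] at this
      linarith
    · linarith
  · have hα : ∀ z, partialP g z = (a * c₂ - c ^ 2 * b * c₁) / c₂ := fun z => by
      rw [← h1 z]; field_simp
    refine ⟨_, hα, ?_, by field_simp⟩
    have := h3 0 0 0 0 0
    rw [funext hα] at this
    simp only [fderiv_fun_const, Pi.zero_apply, zero_apply, zero_mul] at this
    linarith

lemma eq_add_of_partialP_eq {g : ℝ → ℝ → ℝ → ℝ → ℝ} (hg : NonSingular 1 g) {α : ℝ}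
    (h : ∀ z, partialP g z = α) (t x y p : ℝ) : g t x y p = α * p + g t x y 0 := by
  have hd : Differentiable ℝ (uncurry4 g) := ContDiff.differentiable hg (by simp)
  have hder : ∀ p, HasDerivAt (fun p => g t x y p - α * p) 0 p := by
    intro p
    have d1 : HasDerivAt (fun p => g t x y p) (partialP g (t, x, y, p)) p :=
      HasFDerivAt.comp_hasDerivAt (f := fun p => (t, x, y, p)) p (hd _).hasFDerivAt
        ((hasDerivAt_const p t).prodMk ((hasDerivAt_const p x).prodMk
        ((hasDerivAt_const p y).prodMk (hasDerivAt_id p))))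
    rw [h] at d1
    exact (d1.sub ((hasDerivAt_id p).const_mul α)).congr_deriv (by ring)
  have := is_const_of_deriv_eq_zero (fun p => (hder p).differentiableAt)
    (fun p => (hder p).deriv) p 0
  simp only [mul_zero, sub_zero] at this
  linarith

/-- Solution of the transport equation `H_t + v H_x - κ y H_y = -N H` by characteristics. -/
lemma eq_of_transport {H : ℝ × ℝ × ℝ → ℝ} (hH : Differentiable ℝ H) {v κ N : ℝ}
    (h : ∀ t x y, fderiv ℝ H (t, x, y) (1, v, -(κ * y)) = -(N * H (t, x, y))) (t x y : ℝ) :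
    H (t, x, y) = H (0, x - v * t, Real.exp (κ * t) * y) * Real.exp (-(N * t)) := by
  -- `e^{Nτ} H` is constant along the characteristic through `(t, x, y)`
  have hder : ∀ τ, HasDerivAt (fun τ => Real.exp (N * τ) *
      H (τ, x - v * t + v * τ, Real.exp (κ * t - κ * τ) * y)) 0 τ := by
    intro τ
    have l : ∀ k : ℝ, HasDerivAt (fun τ : ℝ => k * τ) k τ := fun k => by
      simpa using (hasDerivAt_id τ).const_mul k
    have d := HasFDerivAt.comp_hasDerivAt
      (f := fun τ => (τ, x - v * t + v * τ, Real.exp (κ * t - κ * τ) * y)) τ (hH _).hasFDerivAt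
      ((hasDerivAt_id τ).prodMk (((l v).const_add (x - v * t)).prodMk
        ((((l κ).const_sub (κ * t)).exp).mul_const y)))
    rw [show Real.exp (κ * t - κ * τ) * -κ * y = -(κ * (Real.exp (κ * t - κ * τ) * y)) by ring,
      h] at d
    refine ((l N).exp.mul d).congr_deriv ?_
    simp only [Function.comp_apply]
    ring
  have key := is_const_of_deriv_eq_zero (fun p => (hder p).differentiableAt)
    (fun p => (hder p).deriv) t 0
  simp only [mul_zero, sub_self, sub_zero, Real.exp_zero, one_mul, add_zero, sub_add_cancel] at key
  rw [← key, Real.exp_neg]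
  field_simp

/-- The wave equations that have a multiplier of energy-momentum type, with the multipliers. The
function `f` is the restriction of `g` to `t = 0`, `p = 0` (in the first family to `x = 0`,
`p = 0`), in the last family minus a linear term. -/
lemma classification {g : ℝ → ℝ → ℝ → ℝ → ℝ} {c a b c₁ c₂ c₀ : ℝ} {T Ψ : FieldExpr}
    (hm : 2 ≤ m) (hm' : m ≤ ∞) (hc : 0 < c) (hg : NonSingular m g)
    (hne : (c₁, c₂, c₀) ≠ (0, 0, 0))
    (h : IsConservationLaw m c g (linMultiplier a b c₁ c₂ c₀) T Ψ) :
    (c₁ = 0 ∧ c₀ = 0 ∧ b = 0 ∧ c₂ ≠ 0 ∧ ∃ f, IsC m f ∧ g = momentumTerm a f) ∨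
    (c₁ ≠ 0 ∧ b = 0 ∧ c₀ = a / 2 * c₁ ∧ ∃ f, IsC m f ∧ g = energyTerm a (c₂ / c₁) f) ∨
    (c₁ ≠ 0 ∧ ∃ s : ℝ, (s = 1 ∨ s = -1) ∧ c₂ = -(s * c) * c₁ ∧ c₀ = (a + s * c * b) / 2 * c₁ ∧
      ∃ f, IsC m f ∧ g = nullTerm c s a b f) := by
  obtain ⟨h1, h2, h3, h4⟩ := determining_system hm hm' hc hg h
  obtain ⟨α, hα, hα1, hα2⟩ := exists_partialP_eq hc (ContDiff.of_le hg hm) hne h1 h2 h3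
  have hg1 : NonSingular 1 g := ContDiff.of_le hg (one_le_two.trans hm)
  have hgα := eq_add_of_partialP_eq hg1 hα
  have hGd : Differentiable ℝ (uncurry4 g) := ContDiff.differentiable hg1 (by simp)
  replace h4 := fun t x y => h4 t x y (by rw [funext hα]; simp)
  simp only [hα] at h4
  have hslice : ∀ f : ℝ × ℝ → ℝ × ℝ × ℝ × ℝ, ContDiff ℝ m f →
      ContDiff ℝ m fun z => uncurry4 g (f z) := fun f hf => ContDiff.comp hg hf
  -- the last condition on `l` makes the transport equation for `g(t,x,y,0) - l y` homogeneous
  have transport : ∀ l M N κ v : ℝ, c₁ ≠ 0 → c₂ = v * c₁ → c₀ = κ * c₁ →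
      (a ^ 2 - c ^ 2 * b ^ 2 - a * α) * κ = M → a + b * v - κ = N → M - N * l + κ * l = 0 →
      ∀ t x y, g t x y 0 = l * y + (g 0 (x - v * t) (Real.exp (κ * t) * y) 0
        - l * (Real.exp (κ * t) * y)) * Real.exp (-(N * t)) := by
    intro l M N κ v hc₁ e1 e2 e3 e4 e5 t x y
    let ι : ℝ × ℝ × ℝ → ℝ × ℝ × ℝ × ℝ := fun z => (z.1, z.2.1, z.2.2, 0)
    have hι : ∀ z, HasFDerivAt ι ((ContinuousLinearMap.fst ℝ ℝ (ℝ × ℝ)).prod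
        (((ContinuousLinearMap.fst ℝ ℝ ℝ).comp (ContinuousLinearMap.snd ℝ ℝ (ℝ × ℝ))).prod
        (((ContinuousLinearMap.snd ℝ ℝ ℝ).comp (ContinuousLinearMap.snd ℝ ℝ (ℝ × ℝ))).prod 0))) z :=
      fun z => hasFDerivAt_fst.prodMk ((hasFDerivAt_fst.comp z hasFDerivAt_snd).prodMk
        ((hasFDerivAt_snd.comp z hasFDerivAt_snd).prodMk (hasFDerivAt_const 0 z)))
    have hl : ∀ z : ℝ × ℝ × ℝ, HasFDerivAt (fun z : ℝ × ℝ × ℝ => l * z.2.2)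
        (l • ((ContinuousLinearMap.snd ℝ ℝ ℝ).comp (ContinuousLinearMap.snd ℝ ℝ (ℝ × ℝ)))) z :=
      fun z => (hasFDerivAt_snd.comp z hasFDerivAt_snd).const_mul l
    have hH : ∀ z, HasFDerivAt (fun z => uncurry4 g (ι z) - l * z.2.2) _ z := fun z =>
      ((hGd (ι z)).hasFDerivAt.comp z (hι z)).sub (hl z)
    have := eq_of_transport (v := v) (κ := κ) (N := N) (fun z => (hH z).differentiableAt) ?_ t x y
    · simp only [uncurry4, ι] at this
      linarith
    · intro t x y
      rw [(hH _).fderiv]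
      refine mul_left_cancel₀ hc₁ ?_
      have key := h4 t x y
      rw [e1, e2] at key
      simp only [ι, sub_apply, ContinuousLinearMap.comp_apply,
        ContinuousLinearMap.prod_apply, ContinuousLinearMap.coe_fst', ContinuousLinearMap.coe_snd',
        zero_apply, smul_apply, smul_eq_mul]
      rw [map_quadruple]
      simp only [uncurry4] at key ⊢
      subst e3 e4
      linear_combination key + c₁ * y * e5
  by_cases hc₁ : c₁ = 0
  · left
    subst hc₁
    have hc₂ : c₂ ≠ 0 := by
      rintro rfl
      refine hne ?_
      have : c₀ = 0 := by linarith
      rw [this]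
    have hb : b = 0 := by
      have : b * c₂ = 0 := by linarith
      exact (mul_eq_zero.1 this).resolve_right hc₂
    subst hb
    have hc₀ : c₀ = 0 := by linarith
    subst hc₀
    have ha : α = a := by
      refine mul_left_cancel₀ hc₂ ?_
      linear_combination hα2
    refine ⟨rfl, rfl, rfl, hc₂, fun t y => g t 0 y 0,
      hslice (fun z => (z.1, 0, z.2, 0)) (by fun_prop), ?_⟩
    have hder : ∀ t y x, HasDerivAt (fun x => g t x y 0) 0 x := by
      intro t y x
      have d : HasDerivAt (fun x => g t x y 0)
          (fderiv ℝ (uncurry4 g) (t, x, y, 0) (0, 1, 0, 0)) x :=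
        HasFDerivAt.comp_hasDerivAt (f := fun x => (t, x, y, (0 : ℝ))) x (hGd _).hasFDerivAt
          ((hasDerivAt_const x t).prodMk ((hasDerivAt_id x).prodMk
          ((hasDerivAt_const x y).prodMk (hasDerivAt_const x 0))))
      have e := h4 t x y
      have e0 : c₂ * fderiv ℝ (uncurry4 g) (t, x, y, 0) (0, 1, 0, 0) = 0 := by
        linear_combination e
      rwa [(mul_eq_zero.1 e0).resolve_left hc₂] at d
    funext t x y p
    rw [hgα, momentumTerm, ha, is_const_of_deriv_eq_zero (fun x => (hder t y x).differentiableAt)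
      (fun x => (hder t y x).deriv) x 0]
  · right
    by_cases hb : b = 0
    · left
      subst hb
      have ha : α = a := by
        refine mul_left_cancel₀ hc₁ ?_
        linear_combination hα1
      have hc₀ : c₀ = a / 2 * c₁ := by linarith
      refine ⟨hc₁, rfl, hc₀, fun ξ w => g 0 ξ w 0,
        hslice (fun z => (0, z.1, z.2, 0)) (by fun_prop), ?_⟩
      funext t x y p
      have := transport 0 0 (a / 2) (a / 2) (c₂ / c₁) hc₁ (by field_simp) hc₀
        (by rw [ha]; ring) (by ring) (by ring) t x y
      rw [hgα, energyTerm, ha, this]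
      ring
    · right
      -- the two expressions for `α` agree only if `c₂ = ± c c₁`
      have hs : c₂ ^ 2 = (c * c₁) ^ 2 := by
        refine mul_left_cancel₀ hb ?_
        linear_combination c₂ * hα1 - c₁ * hα2
      have hs' : ∃ s : ℝ, (s = 1 ∨ s = -1) ∧ c₂ = -(s * c) * c₁ := by
        rcases sq_eq_sq_iff_eq_or_eq_neg.1 hs with e | e
        · exact ⟨-1, Or.inr rfl, by rw [e]; ring⟩
        · exact ⟨1, Or.inl rfl, by rw [e]; ring⟩
      obtain ⟨s, s1, hc₂⟩ := hs'
      have ss : s ^ 2 = 1 := by rcases s1 with rfl | rfl <;> norm_num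
      have ha : α = a + s * c * b := by
        refine mul_left_cancel₀ hc₁ ?_
        rw [hα1, hc₂]; ring
      have hc₀ : c₀ = (a + s * c * b) / 2 * c₁ := by
        rw [hc₂] at h2
        linarith
      refine ⟨hc₁, s, s1, hc₂, hc₀, fun ξ w => g 0 ξ w 0 - 1 / 4 * (a + s * c * b) ^ 2 * w,
        ContDiff.sub (hslice (fun z => (0, z.1, z.2, 0)) (by fun_prop)) (by fun_prop), ?_⟩
      funext t x y p
      have := transport (1 / 4 * (a + s * c * b) ^ 2) _ ((a - 3 * s * c * b) / 2)
        ((a + s * c * b) / 2) (-(s * c)) hc₁ hc₂ hc₀ rfl (by ring)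
        (by rw [ha]; linear_combination (1 / 2 * (a + s * c * b) * c ^ 2 * b ^ 2) * ss) t x y
      rw [hgα, nullTerm, ha, this, show x - -(s * c) * t = x + s * c * t by ring]
      ring

end

/-! ### First-order conservation laws and the divergence identities -/

section

open MeasureTheory Topology Filter

/-- The primitive `∫₀^w f(y, s) ds`. In contrast to `antideriv`, which is a primitive of `f(y, κ u)`
in `u`, it does not contain `κ`; the two are related by `mul_antideriv`. -/
noncomputable def primitive (f : ℝ → ℝ → ℝ) : ℝ → ℝ → ℝ := fun y w => ∫ s in (0 : ℝ)..w, f y s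

lemma mul_antideriv (f : ℝ → ℝ → ℝ) (y κ u : ℝ) :
    κ * antideriv f y κ u = primitive f y (κ * u) := by
  simp [antideriv, primitive, intervalIntegral.mul_integral_comp_mul_left (f := fun s => f y s)]

lemma isC_primitive {m : ℕ∞} {f : ℝ → ℝ → ℝ} (hf : IsC m f) : IsC m (primitive f) :=
  contDiff_primitive_param (f := fun z : ℝ × ℝ => f z.1 z.2) hf

lemma contDiff_antideriv {m : ℕ∞} {f : ℝ → ℝ → ℝ} (hf : IsC m f) :
    ContDiff ℝ m fun q : (ℝ × ℝ) × ℝ => antideriv f q.1.1 q.1.2 q.2 :=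
  contDiff_primitive_param (f := fun q : (ℝ × ℝ) × ℝ => f q.1.1 (q.1.2 * q.2))
    (ContDiff.comp (g := fun z : ℝ × ℝ => f z.1 z.2) hf
      (f := fun q : (ℝ × ℝ) × ℝ => (q.1.1, q.1.2 * q.2)) (by fun_prop))

lemma dx_primitive {f : ℝ → ℝ → ℝ} (hf : IsC 1 f) (y w : ℝ) : dx (primitive f) y w = f y w :=
  ((hf.slice y).continuous.integral_hasStrictDerivAt 0 w).hasDerivAt.deriv

/-- Chain rule for the primitive along a curve. -/
lemma hasDerivAt_primitive {f : ℝ → ℝ → ℝ} (hf : IsC 1 f) {Y w : ℝ → ℝ} {Y' w' τ : ℝ}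
    (hY : HasDerivAt Y Y' τ) (hw : HasDerivAt w w' τ) :
    HasDerivAt (fun τ => primitive f (Y τ) (w τ))
      (Y' * dt (primitive f) (Y τ) (w τ) + w' * f (Y τ) (w τ)) τ := by
  have hp : IsC 1 (primitive f) := isC_primitive (m := 1) hf
  have := HasFDerivAt.comp_hasDerivAt (f := fun τ => (Y τ, w τ)) τ
    (hp.differentiableAt le_rfl _).hasFDerivAt (hY.prodMk hw)
  rw [← dx_primitive hf, hp.dt_eq_fderiv le_rfl, hp.dx_eq_fderiv le_rfl]
  refine this.congr_deriv ?_
  have e : ((Y', w') : ℝ × ℝ) = Y' • (1, 0) + w' • (0, 1) := by simp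
  rw [e, map_add, map_smul, map_smul]
  simp

/-- The differential expression `Φ(t, x, u, u_t, u_x)`. -/
noncomputable def firstOrder (Φ : ℝ × ℝ × ℝ × ℝ × ℝ → ℝ) : FieldExpr :=
  fun u t x => Φ (t, x, u t x, dt u t x, dx u t x)

lemma isDiffFunction_firstOrder {m : WithTop ℕ∞} {Φ : ℝ × ℝ × ℝ × ℝ × ℝ → ℝ} (h : ContDiff ℝ m Φ) :
    IsDiffFunction m (firstOrder Φ) := by
  refine ⟨1, fun q => Φ (q.1.1, q.1.2, q.2.1 0, q.2.2 0, q.2.1 1), h.comp (by fun_prop),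
    fun u _ t x => rfl⟩

lemma isC_firstOrder {m : WithTop ℕ∞} {Φ : ℝ × ℝ × ℝ × ℝ × ℝ → ℝ} (h : ContDiff ℝ m Φ) {u : Field}
    (hu : IsC (m + 1) u) : IsC m (firstOrder Φ u) :=
  h.comp (contDiff_fst.prodMk (contDiff_snd.prodMk ((hu.of_le le_self_add).prodMk
    (ContDiff.prodMk (hu.dt le_rfl) (hu.dx le_rfl)))))

/-- A divergence identity with first-order density and flux is a conservation law, and yields a
conserved integral. -/
lemma isConserved_of_firstOrder {m : WithTop ℕ∞} (hm : 1 ≤ m) {c : ℝ}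
    {g : ℝ → ℝ → ℝ → ℝ → ℝ} {Q T Ψ : FieldExpr} {Φ₁ Φ₂ : ℝ × ℝ × ℝ × ℝ × ℝ → ℝ}
    (h₁ : ContDiff ℝ m Φ₁) (h₂ : ContDiff ℝ m Φ₂) (hT : T = firstOrder Φ₁) (hΨ : Ψ = firstOrder Φ₂)
    (hid : ∀ u : Field, IsC 2 u → ∀ t x,
      waveExpr c g u t x * Q u t x = dt (T u) t x + dx (Ψ u) t x) :
    IsConservationLaw m c g Q T Ψ ∧ IsConserved c g T Ψ := by
  refine ⟨⟨hT ▸ isDiffFunction_firstOrder h₁, hΨ ▸ isDiffFunction_firstOrder h₂,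
    fun u hu => hid u (hu.of_le two_le_infty)⟩, ?_⟩
  rintro u ⟨hu, hsol⟩ hint hflux t₁ t₂
  have hu' : IsC (1 + 1) u := by rwa [one_add_one_eq_two]
  have cT : IsC 1 (T u) := hT ▸ isC_firstOrder (h₁.of_le hm) hu'
  have cΨ : IsC 1 (Ψ u) := hΨ ▸ isC_firstOrder (h₂.of_le hm) hu'
  have hdiv : ∀ t x, dt (T u) t x + dx (Ψ u) t x = 0 := fun t x => by
    rw [← hid u hu, hsol, zero_mul]
  have lim : ∀ t, Tendsto (fun R : ℝ => ∫ x in (-R)..R, T u t x) atTop (𝓝 (consIntegral T u t)) :=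
    fun t => intervalIntegral_tendsto_integral (hint t) tendsto_neg_atTop_atBot tendsto_id
  have flux : Tendsto (fun R : ℝ => ∫ t in t₁..t₂, (Ψ u t R - Ψ u t (-R))) atTop (𝓝 0) := by
    have hunif := (tendstoLocallyUniformly_iff_forall_isCompact.1 hflux) (Set.uIcc t₁ t₂)
      isCompact_uIcc
    rw [Metric.tendstoUniformlyOn_iff] at hunif
    rw [Metric.tendsto_nhds]
    intro ε hε
    have hpos : 0 < |t₂ - t₁| + 1 := by positivity
    filter_upwards [hunif (ε / (|t₂ - t₁| + 1)) (by positivity)] with R hR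
    rw [dist_zero_right]
    refine (intervalIntegral.norm_integral_le_of_norm_le_const
      (C := ε / (|t₂ - t₁| + 1)) fun t ht => ?_).trans_lt ?_
    · have := hR t (Set.uIoc_subset_uIcc ht)
      rw [dist_zero_left] at this
      exact this.le
    · rw [div_mul_eq_mul_div, div_lt_iff₀ hpos]
      nlinarith
  have green : ∀ R : ℝ, (∫ t in t₁..t₂, (Ψ u t R - Ψ u t (-R))) =
      (∫ x in (-R)..R, T u t₁ x) - ∫ x in (-R)..R, T u t₂ x := by
    intro R
    have := integral_sub_eq_of_divergence_eq_zero cT cΨ hdiv (-R) R t₁ t₂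
    rw [intervalIntegral.integral_sub ((cΨ.slice_fst R).continuous.intervalIntegrable _ _)
      ((cΨ.slice_fst (-R)).continuous.intervalIntegrable _ _)]
    linarith
  simp only [green] at flux
  have := tendsto_nhds_unique flux ((lim t₁).sub (lim t₂))
  linarith

/-- The first and second partial derivatives of a `C²` field, as derivatives of its slices. -/
lemma IsC.hasDerivAt_all {u : Field} (hu : IsC 2 u) (t x : ℝ) :
    HasDerivAt (fun τ => u τ x) (DampedWave.dt u t x) t ∧
    HasDerivAt (fun ξ => u t ξ) (DampedWave.dx u t x) x ∧
    HasDerivAt (fun τ => DampedWave.dt u τ x) (DampedWave.dt (DampedWave.dt u) t x) t ∧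
    HasDerivAt (fun ξ => DampedWave.dt u t ξ) (DampedWave.dx (DampedWave.dt u) t x) x ∧
    HasDerivAt (fun τ => DampedWave.dx u τ x) (DampedWave.dx (DampedWave.dt u) t x) t ∧
    HasDerivAt (fun ξ => DampedWave.dx u t ξ) (DampedWave.dx (DampedWave.dx u) t x) x := by
  have h11 : (1 : WithTop ℕ∞) + 1 ≤ 2 := by rw [one_add_one_eq_two]
  refine ⟨hu.hasDerivAt_dt one_le_two t x, hu.hasDerivAt_dx one_le_two t x,
    (hu.dt h11).hasDerivAt_dt le_rfl t x, (hu.dt h11).hasDerivAt_dx le_rfl t x, ?_,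
    (hu.dx h11).hasDerivAt_dx le_rfl t x⟩
  rw [← hu.dt_dx_comm le_rfl]
  exact (hu.dx h11).hasDerivAt_dt le_rfl t x

lemma hasDerivAt_const_mul_id (k t : ℝ) : HasDerivAt (fun τ => k * τ) k t := by
  simpa using (hasDerivAt_id t).const_mul k

lemma momentum_identity (c a : ℝ) {f : ℝ → ℝ → ℝ} (hf : IsC 1 f) {u : Field} (hu : IsC 2 u)
    (t x : ℝ) : waveExpr c (momentumTerm a f) u t x * momentumMultiplier a u t x =
      dt (momentumDensity a u) t x + dx (momentumFlux c a f u) t x := by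
  obtain ⟨d1, d2, d3, d4, d5, d6⟩ := hu.hasDerivAt_all t x
  have e1 := ((hasDerivAt_const_mul_id a t).exp.mul d3).mul d5
  have p : ∀ ξ, antideriv f t 1 (u t ξ) = primitive f t (u t ξ) := fun ξ => by
    simpa using mul_antideriv f t 1 (u t ξ)
  have e2 := ((((d4.pow 2).add ((d6.pow 2).const_mul (c ^ 2))).const_mul (1 / 2)).const_mul
      (-Real.exp (a * t))).add ((hasDerivAt_primitive hf (hasDerivAt_const x t) d2).const_mul
      (Real.exp (a * t)))
  simp only [dt, dx, momentumDensity, momentumFlux, p] at e1 e2 ⊢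
  refine Eq.trans ?_ (congrArg₂ (· + ·) e1.deriv e2.deriv).symm
  simp only [waveExpr, momentumTerm, momentumMultiplier, Pi.mul_apply, dt, dx]
  push_cast
  ring

lemma energy_identity (c a v : ℝ) {f : ℝ → ℝ → ℝ} (hf : IsC 1 f) {u : Field} (hu : IsC 2 u)
    (t x : ℝ) : waveExpr c (energyTerm a v f) u t x * energyMultiplier a v u t x =
      dt (energyDensity c a v f u) t x + dx (energyFlux c a v f u) t x := by
  obtain ⟨d1, d2, d3, d4, d5, d6⟩ := hu.hasDerivAt_all t x
  have ex : ∀ k τ : ℝ, HasDerivAt (fun τ => Real.exp (k * τ)) (k * Real.exp (k * τ)) τ :=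
    fun k τ => (hasDerivAt_const_mul_id k τ).exp.congr_deriv (mul_comm _ _)
  have e1 := ((ex a t).mul ((((d3.pow 2).add ((d5.pow 2).const_mul (c ^ 2))).const_mul (1 / 2)).add
      (((d5.const_mul v).add (d1.const_mul (1 / 2 * a))).mul d3))).add
      (hasDerivAt_primitive hf ((hasDerivAt_const_mul_id v t).const_sub x) ((ex (a / 2) t).mul d1))
  have e2 := ((((((d4.pow 2).add ((d6.pow 2).const_mul (c ^ 2))).const_mul (1 / 2 * v))).add
      (((d4.add (d2.const_mul (1 / 2 * a))).const_mul (c ^ 2)).mul d6)).const_mul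
      (-Real.exp (a * t))).add ((hasDerivAt_primitive hf ((hasDerivAt_id x).sub_const (v * t))
      (d2.const_mul (Real.exp (a / 2 * t)))).const_mul v)
  simp only [dt, dx, energyDensity, energyFlux, mul_assoc v, mul_antideriv] at e1 e2 ⊢
  refine Eq.trans ?_ (congrArg₂ (· + ·) e1.deriv e2.deriv).symm
  have h1 : Real.exp (a * t) = Real.exp (a / 2 * t) * Real.exp (a / 2 * t) := by
    rw [← Real.exp_add]; ring_nf
  have h2 : Real.exp (a / 2 * t) * Real.exp (-(a / 2 * t)) = 1 := by
    rw [← Real.exp_add, add_neg_cancel, Real.exp_zero]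
  simp only [waveExpr, energyTerm, energyMultiplier, dt, dx, Pi.add_apply, Pi.mul_apply,
    Pi.pow_apply, id_eq]
  push_cast
  rw [h1]
  linear_combination (f (x - v * t) (Real.exp (a / 2 * t) * u t x) * Real.exp (a / 2 * t)
    * (deriv (fun τ => u τ x) t + v * deriv (fun ξ => u t ξ) x + a / 2 * u t x)) * h2

/-- The potential term of the null energies, in which `f` enters only through its primitive. -/
lemma exp_mul_antideriv (f : ℝ → ℝ → ℝ) (c s a b t x u : ℝ) :
    Real.exp ((a + 3 * s * c * b) / 2 * t + b * x)
      * antideriv f (x + s * c * t) (Real.exp ((a + s * c * b) / 2 * t)) u =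
    Real.exp (b * (s * c) * t + b * x) *
      primitive f (x + s * c * t) (Real.exp ((a + s * c * b) / 2 * t) * u) := by
  rw [← mul_antideriv, ← mul_assoc, ← Real.exp_add]
  ring_nf

lemma null_identity (c s a b : ℝ) (hs : s ^ 2 = 1) {f : ℝ → ℝ → ℝ} (hf : IsC 1 f) {u : Field}
    (hu : IsC 2 u) (t x : ℝ) :
    waveExpr c (nullTerm c s a b f) u t x * nullMultiplier c s a b u t x =
      dt (nullDensity c s a b f u) t x + dx (nullFlux c s a b f u) t x := by
  obtain ⟨d1, d2, d3, d4, d5, d6⟩ := hu.hasDerivAt_all t x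
  have ex : ∀ k τ : ℝ, HasDerivAt (fun τ => Real.exp (k * τ)) (k * Real.exp (k * τ)) τ :=
    fun k τ => (hasDerivAt_const_mul_id k τ).exp.congr_deriv (mul_comm _ _)
  have e1 := (hasDerivAt_exp_mul_fst (a := a) (b := b)
      ((((d3.sub (d5.const_mul (s * c))).pow 2).const_mul (1 / 2)).add
      (((d3.add (d1.const_mul (1 / 4 * (a + 3 * s * c * b)))).const_mul
        (1 / 2 * (a + s * c * b))).mul d1)) x).add
      (hasDerivAt_exp_mul_fst (a := b * (s * c)) (b := b) (hasDerivAt_primitive hf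
        ((hasDerivAt_const_mul_id (s * c) t).const_add x)
        ((ex ((a + s * c * b) / 2) t).mul d1)) x)
  have e2 := ((hasDerivAt_exp_mul_snd (a := a) (b := b)
      ((((d4.sub (d6.const_mul (s * c))).pow 2).const_mul (1 / 2)).sub
      ((((d6.const_mul (s * c)).add (d2.const_mul (1 / 4 * (a - s * c * b)))).const_mul
        (1 / 2 * (a + s * c * b))).mul d2)) t).const_mul (s * c)).sub
      ((hasDerivAt_exp_mul_snd (a := b * (s * c)) (b := b) (hasDerivAt_primitive hf
        ((hasDerivAt_id x).add_const (s * c * t))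
        (d2.const_mul (Real.exp ((a + s * c * b) / 2 * t)))) t).const_mul (s * c))
  simp only [dt, dx, nullDensity, nullFlux, mul_assoc (s * c), exp_mul_antideriv] at e1 e2 ⊢
  refine Eq.trans ?_ (congrArg₂ (· + ·) e1.deriv e2.deriv).symm
  have h1 : Real.exp (a * t + b * x) * Real.exp (-((a - 3 * s * c * b) / 2 * t)) =
      Real.exp (b * (s * c) * t + b * x) * Real.exp ((a + s * c * b) / 2 * t) := by
    rw [← Real.exp_add, ← Real.exp_add]; ring_nf
  simp only [waveExpr, nullTerm, nullMultiplier, dt, dx, Pi.add_apply, Pi.sub_apply, Pi.mul_apply,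
    Pi.pow_apply, id_eq]
  push_cast
  -- the identity holds up to `(s² - 1) c² u_xx Q`
  linear_combination (f (x + s * c * t) (Real.exp ((a + s * c * b) / 2 * t) * u t x)
    * (deriv (fun τ => u τ x) t - s * c * deriv (fun ξ => u t ξ) x
      + (a + s * c * b) / 2 * u t x)) * h1
    + (Real.exp (a * t + b * x) * c ^ 2 * deriv (fun ξ => deriv (fun ξ => u t ξ) ξ) x
      * (deriv (fun τ => u τ x) t - s * c * deriv (fun ξ => u t ξ) x
        + (a + s * c * b) / 2 * u t x)) * hs

end

/-! ### The three families of conservation laws -/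

section

open MeasureTheory Topology Filter

/-- Smoothness of a potential term `F(y, κ u)` whose arguments depend on `t, x`. -/
lemma contDiff_antideriv_comp {m : ℕ∞} {f : ℝ → ℝ → ℝ} (hf : IsC m f)
    {Y κ : ℝ × ℝ × ℝ × ℝ × ℝ → ℝ} (hY : ContDiff ℝ m Y) (hκ : ContDiff ℝ m κ) :
    ContDiff ℝ m fun q : ℝ × ℝ × ℝ × ℝ × ℝ => antideriv f (Y q) (κ q) q.2.2.1 :=
  (contDiff_antideriv hf).comp ((hY.prodMk hκ).prodMk (by fun_prop))

lemma momentum_law {m : ℕ∞} (hm : 2 ≤ m) (c a : ℝ) {f : ℝ → ℝ → ℝ} (hf : IsC m f) :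
    IsConservationLaw m c (momentumTerm a f) (momentumMultiplier a)
      (momentumDensity a) (momentumFlux c a f) ∧
      IsConserved c (momentumTerm a f) (momentumDensity a) (momentumFlux c a f) := by
  have hm1 : (1 : WithTop ℕ∞) ≤ m := by exact_mod_cast one_le_two.trans hm
  refine isConserved_of_firstOrder hm1
    (Φ₁ := fun q => Real.exp (a * q.1) * q.2.2.2.1 * q.2.2.2.2)
    (Φ₂ := fun q => -Real.exp (a * q.1) * (1 / 2 * (q.2.2.2.1 ^ 2 + c ^ 2 * q.2.2.2.2 ^ 2))
      + Real.exp (a * q.1) * antideriv f q.1 1 q.2.2.1) (by fun_prop) ?_ rfl rfl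
    fun u hu t x => momentum_identity c a (hf.of_le hm1) hu t x
  have := contDiff_antideriv_comp hf (Y := fun q => q.1) (κ := fun _ => 1)
    (by fun_prop) (by fun_prop)
  fun_prop

lemma energy_law {m : ℕ∞} (hm : 2 ≤ m) (c a v : ℝ) {f : ℝ → ℝ → ℝ} (hf : IsC m f) :
    IsConservationLaw m c (energyTerm a v f) (energyMultiplier a v)
      (energyDensity c a v f) (energyFlux c a v f) ∧
      IsConserved c (energyTerm a v f) (energyDensity c a v f) (energyFlux c a v f) := by
  have hm1 : (1 : WithTop ℕ∞) ≤ m := by exact_mod_cast one_le_two.trans hm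
  have := contDiff_antideriv_comp hf (Y := fun q => q.2.1 - v * q.1)
    (κ := fun q => Real.exp (a / 2 * q.1)) (by fun_prop) (by fun_prop)
  refine isConserved_of_firstOrder hm1
    (Φ₁ := fun q => Real.exp (a * q.1) * (1 / 2 * (q.2.2.2.1 ^ 2 + c ^ 2 * q.2.2.2.2 ^ 2)
      + (v * q.2.2.2.2 + 1 / 2 * a * q.2.2.1) * q.2.2.2.1)
      + Real.exp (a / 2 * q.1) * antideriv f (q.2.1 - v * q.1) (Real.exp (a / 2 * q.1)) q.2.2.1)
    (Φ₂ := fun q => -Real.exp (a * q.1) * (1 / 2 * v * (q.2.2.2.1 ^ 2 + c ^ 2 * q.2.2.2.2 ^ 2)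
      + c ^ 2 * (q.2.2.2.1 + 1 / 2 * a * q.2.2.1) * q.2.2.2.2)
      + v * Real.exp (a / 2 * q.1)
        * antideriv f (q.2.1 - v * q.1) (Real.exp (a / 2 * q.1)) q.2.2.1)
    (by fun_prop) (by fun_prop) rfl rfl
    fun u hu t x => energy_identity c a v (hf.of_le hm1) hu t x

lemma null_law {m : ℕ∞} (hm : 2 ≤ m) (c s a b : ℝ) (hs : s = 1 ∨ s = -1) {f : ℝ → ℝ → ℝ}
    (hf : IsC m f) :
    IsConservationLaw m c (nullTerm c s a b f) (nullMultiplier c s a b)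
      (nullDensity c s a b f) (nullFlux c s a b f) ∧
      IsConserved c (nullTerm c s a b f) (nullDensity c s a b f) (nullFlux c s a b f) := by
  have hm1 : (1 : WithTop ℕ∞) ≤ m := by exact_mod_cast one_le_two.trans hm
  have ss : s ^ 2 = 1 := by rcases hs with rfl | rfl <;> norm_num
  have := contDiff_antideriv_comp hf (Y := fun q => q.2.1 + s * c * q.1)
    (κ := fun q => Real.exp ((a + s * c * b) / 2 * q.1)) (by fun_prop) (by fun_prop)
  refine isConserved_of_firstOrder hm1
    (Φ₁ := fun q => Real.exp (a * q.1 + b * q.2.1) * (1 / 2 * (q.2.2.2.1 - s * c * q.2.2.2.2) ^ 2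
      + 1 / 2 * (a + s * c * b) * (q.2.2.2.1 + 1 / 4 * (a + 3 * s * c * b) * q.2.2.1) * q.2.2.1)
      + Real.exp ((a + 3 * s * c * b) / 2 * q.1 + b * q.2.1)
        * antideriv f (q.2.1 + s * c * q.1) (Real.exp ((a + s * c * b) / 2 * q.1)) q.2.2.1)
    (Φ₂ := fun q => s * c * Real.exp (a * q.1 + b * q.2.1)
      * (1 / 2 * (q.2.2.2.1 - s * c * q.2.2.2.2) ^ 2 - 1 / 2 * (a + s * c * b)
        * (s * c * q.2.2.2.2 + 1 / 4 * (a - s * c * b) * q.2.2.1) * q.2.2.1)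
      - s * c * Real.exp ((a + 3 * s * c * b) / 2 * q.1 + b * q.2.1)
        * antideriv f (q.2.1 + s * c * q.1) (Real.exp ((a + s * c * b) / 2 * q.1)) q.2.2.1)
    (by fun_prop) (by fun_prop) rfl rfl
    fun u hu t x => null_identity c s a b ss (hf.of_le hm1) hu t x

/-- Conservation laws with proportional multipliers are proportional up to local equivalence. -/
lemma locallyEquivalent_of_multiplier {m : ℕ∞} (hm : 1 ≤ m) {c k : ℝ} {g : ℝ → ℝ → ℝ → ℝ → ℝ}
    {Q Q' T Ψ T' Ψ' : FieldExpr} (h : IsConservationLaw m c g Q T Ψ)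
    (h' : IsConservationLaw m c g Q' T' Ψ') (hQ : Q = k • Q') :
    LocallyEquivalent m T Ψ (k • T') (k • Ψ') := by
  have hm1 : (1 : WithTop ℕ∞) ≤ m := by exact_mod_cast hm
  have hm' : (m : WithTop ℕ∞) ≤ ∞ := WithTop.coe_le_coe.2 le_top
  obtain ⟨hT, hΨ, hd⟩ := h
  obtain ⟨hT', hΨ', hd'⟩ := h'
  refine exists_potential hm (hT.sub_smul hT' k) (hΨ.sub_smul hΨ' k) ?_
  · intro u hu t x
    have e1 := dt_add_smul (hT.isC hm' hu) (hT'.isC hm' hu) hm1 (-k)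
    have e2 := dx_add_smul (hΨ.isC hm' hu) (hΨ'.isC hm' hu) hm1 (-k)
    have s1 : (T - k • T') u = fun t x => T u t x + -k * T' u t x := by
      funext t x
      change T u t x - k * T' u t x = _
      ring
    have s2 : (Ψ - k • Ψ') u = fun t x => Ψ u t x + -k * Ψ' u t x := by
      funext t x
      change Ψ u t x - k * Ψ' u t x = _
      ring
    change dt ((T - k • T') u) t x + dx ((Ψ - k • Ψ') u) t x = 0
    rw [s1, s2, e1, e2]
    have a1 := hd u hu t x
    have a2 := hd' u hu t x
    rw [hQ, show (k • Q') u t x = k * Q' u t x from rfl] at a1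
    linear_combination k * a2 - a1

end

end DampedWave

theorem theorem1 (m : ℕ∞) (hm : 2 ≤ m) (c : ℝ) (hc : 0 < c) :
    -- every conservation law from a multiplier of the linear form is one of the three families
    (∀ g : ℝ → ℝ → ℝ → ℝ → ℝ, NonSingular m g →
      ∀ a b c₁ c₂ c₀ : ℝ, (c₁, c₂, c₀) ≠ (0, 0, 0) →
      ∀ T Ψ : FieldExpr, IsConservationLaw m c g (linMultiplier a b c₁ c₂ c₀) T Ψ →
        (∃ k : ℝ, k ≠ 0 ∧ ∃ f : ℝ → ℝ → ℝ, IsC m f ∧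
          g = momentumTerm a f ∧
          linMultiplier a b c₁ c₂ c₀ = k • momentumMultiplier a ∧
          LocallyEquivalent m T Ψ (k • momentumDensity a) (k • momentumFlux c a f)) ∨
        (∃ k : ℝ, k ≠ 0 ∧ ∃ (v : ℝ) (f : ℝ → ℝ → ℝ), IsC m f ∧
          g = energyTerm a v f ∧
          linMultiplier a b c₁ c₂ c₀ = k • energyMultiplier a v ∧
          LocallyEquivalent m T Ψ (k • energyDensity c a v f) (k • energyFlux c a v f)) ∨
        (∃ k : ℝ, k ≠ 0 ∧ ∃ s : ℝ, (s = 1 ∨ s = -1) ∧ ∃ f : ℝ → ℝ → ℝ, IsC m f ∧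
          g = nullTerm c s a b f ∧
          linMultiplier a b c₁ c₂ c₀ = k • nullMultiplier c s a b ∧
          LocallyEquivalent m T Ψ (k • nullDensity c s a b f) (k • nullFlux c s a b f))) ∧
    -- generalized momentum
    (∀ (a : ℝ) (f : ℝ → ℝ → ℝ), IsC m f →
      IsConservationLaw m c (momentumTerm a f) (momentumMultiplier a)
        (momentumDensity a) (momentumFlux c a f) ∧
      consIntegral (momentumDensity a) = genMomentum a ∧
      IsConserved c (momentumTerm a f) (momentumDensity a) (momentumFlux c a f)) ∧
    -- generalized energy
    (∀ (a v : ℝ) (f : ℝ → ℝ → ℝ), IsC m f →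
      IsConservationLaw m c (energyTerm a v f) (energyMultiplier a v)
        (energyDensity c a v f) (energyFlux c a v f) ∧
      consIntegral (energyDensity c a v f) = genEnergy c a v f ∧
      IsConserved c (energyTerm a v f) (energyDensity c a v f) (energyFlux c a v f)) ∧
    -- generalized null energies
    (∀ s : ℝ, (s = 1 ∨ s = -1) → ∀ (a b : ℝ) (f : ℝ → ℝ → ℝ), IsC m f →
      IsConservationLaw m c (nullTerm c s a b f) (nullMultiplier c s a b)
        (nullDensity c s a b f) (nullFlux c s a b f) ∧
      consIntegral (nullDensity c s a b f) = genNullEnergy c s a b f ∧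
      IsConserved c (nullTerm c s a b f) (nullDensity c s a b f) (nullFlux c s a b f)) := by
  have hm1 : 1 ≤ m := one_le_two.trans hm
  have hm2 : (2 : WithTop ℕ∞) ≤ m := WithTop.coe_le_coe.2 hm
  have hm' : (m : WithTop ℕ∞) ≤ ∞ := WithTop.coe_le_coe.2 le_top
  refine ⟨fun g hg a b c₁ c₂ c₀ hne T Ψ h => ?_, fun a f hf => ?_, fun a v f hf => ?_,
    fun s hs a b f hf => ?_⟩
  · -- in every family the factor is the leading coefficient of the multiplier: `c₂` or `c₁`
    rcases classification hm2 hm' hc hg hne h with ⟨rfl, rfl, rfl, hc₂, f, hf, rfl⟩ |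
      ⟨hc₁, rfl, hc₀, f, hf, hgf⟩ | ⟨hc₁, s, hs, hc₂, hc₀, f, hf, rfl⟩
    · have hQ : linMultiplier a 0 0 c₂ 0 = c₂ • momentumMultiplier a := by
        funext u t x
        change Real.exp (a * t + 0 * x) * _ = c₂ * (Real.exp (a * t) * dx u t x)
        rw [zero_mul, add_zero]
        ring
      exact Or.inl ⟨c₂, hc₂, f, hf, rfl, hQ,
        locallyEquivalent_of_multiplier hm1 h (momentum_law hm c a hf).1 hQ⟩
    · have hQ : linMultiplier a 0 c₁ c₂ c₀ = c₁ • energyMultiplier a (c₂ / c₁) := by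
        funext u t x
        change Real.exp (a * t + 0 * x) * _ =
          c₁ * (Real.exp (a * t) * (dt u t x + c₂ / c₁ * dx u t x + a / 2 * u t x))
        rw [zero_mul, add_zero, hc₀]
        field_simp
      rw [hgf] at h
      exact Or.inr (Or.inl ⟨c₁, hc₁, c₂ / c₁, f, hf, hgf, hQ,
        locallyEquivalent_of_multiplier hm1 h (energy_law hm c a _ hf).1 hQ⟩)
    · have hQ : linMultiplier a b c₁ c₂ c₀ = c₁ • nullMultiplier c s a b := by
        funext u t x
        change _ = c₁ * (Real.exp (a * t + b * x) *
          (dt u t x - s * c * dx u t x + (a + s * c * b) / 2 * u t x))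
        rw [linMultiplier, hc₂, hc₀]
        ring
      exact Or.inr (Or.inr ⟨c₁, hc₁, s, hs, f, hf, rfl, hQ,
        locallyEquivalent_of_multiplier hm1 h (null_law hm c s a b hs hf).1 hQ⟩)
  · exact ⟨(momentum_law hm c a hf).1, rfl, (momentum_law hm c a hf).2⟩
  · refine ⟨(energy_law hm c a v hf).1, ?_, (energy_law hm c a v hf).2⟩
    funext u t
    simp only [consIntegral, genEnergy, energyDensity]
    congr 1
    funext x
    ring
  · refine ⟨(null_law hm c s a b hs hf).1, ?_, (null_law hm c s a b hs hf).2⟩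
    funext u t
    simp only [consIntegral, genNullEnergy, nullDensity]
    congr 1
    funext x
    ring
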